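/- Let $n\ge 1$, $s\in(0,1)$, $1<p<\infty$ with $n>sp$, and let $\Omega\subset\mathbb R^n$ be a bounded domain with smooth boundary. Let $\lambda>0$, $0<q\le 1$, and let $\alpha\in\mathbb R$ with $\alpha\le p_s^*-1$, where $p_s^*=\frac{np}{n-sp}$. Put $Q=\mathbb R^{2n}\setminus\big((\mathbb R^n\setminus\Omega)\times(\mathbb R^n\setminus\Omega)\big)$ and let $X_0$ be the space of measurable functions $u:\mathbb R^n\to\mathbb R$ with $u|_\Omega\in L^p(\Omega)$, $\frac{u(x)-u(y)}{|x-y|^{(n+sp)/p}}\in L^p(Q)$ and $u=0$ a.e. in $\mathbb R^n\setminus\Omega$. A function $u\in X_0$ is called a positive weak solution of $$(P_\lambda):\qquad (-\Delta_p)^su=\lambda u^{-q}+u^{\alpha},\quad u>0\ \text{in }\Omega,\qquad u=0\ \text{in }\mathbb R^n\setminus\Omega,$$ if $u>0$ a.e. in $\Omega$ and, for every $\psi\in C_c^\infty(\Omega)$, the function $(\lambda u^{-q}+u^{\alpha})\psi$ is integrable on $\Omega$ and $$\int_Q\frac{|u(x)-u(y)|^{p-2}(u(x)-u(y))(\psi(x)-\psi(y))}{|x-y|^{n+sp}}\,dx\,dy-\int_\Omega\left(\lambda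 u^{-q}+u^{\alpha}\right)\psi\,dx=0 .$$ Then every positive weak solution $u$ of $(P_\lambda)$ belongs to $L^\infty(\Omega)$. -/

import Mathlib

open MeasureTheory
open scoped ContDiff

namespace FracPLap

/-- A bounded domain in `ℝⁿ` with smooth boundary: a nonempty, connected, open, bounded set which,
near each of its boundary points, is the sublevel set `{ρ < 0}` of a `C^∞` function `ρ`
with non-vanishing differential at that point. -/
structure IsSmoothBoundedDomain {n : ℕ} (Ω : Set (EuclideanSpace ℝ (Fin n))) : Prop where
  isOpen : IsOpen Ω
  isConnected : IsConnected Ω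
  isBounded : Bornology.IsBounded Ω
  smooth_boundary : ∀ x ∈ frontier Ω,
    ∃ (U : Set (EuclideanSpace ℝ (Fin n))) (ρ : EuclideanSpace ℝ (Fin n) → ℝ),
      IsOpen U ∧ x ∈ U ∧ ContDiffOn ℝ ∞ ρ U ∧ fderiv ℝ ρ x ≠ 0 ∧
      Ω ∩ U = {y ∈ U | ρ y < 0}

/-- The fractional critical Sobolev exponent `p*_s = np / (n - sp)` (used for `n > sp`). -/
noncomputable def critExp (n : ℕ) (s p : ℝ) : ℝ := (n : ℝ) * p / ((n : ℝ) - s * p)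

/-- `Q = ℝ²ⁿ \ (Ωᶜ × Ωᶜ)`. -/
def Q {n : ℕ} (Ω : Set (EuclideanSpace ℝ (Fin n))) :
    Set (EuclideanSpace ℝ (Fin n) × EuclideanSpace ℝ (Fin n)) :=
  (Ωᶜ ×ˢ Ωᶜ)ᶜ

/-- The space `X`: Lebesgue measurable functions `u : ℝⁿ → ℝ` with `u|_Ω ∈ L^p(Ω)` and
`(u(x) - u(y)) / |x - y|^((n + sp)/p) ∈ L^p(Q)`. -/
structure MemX {n : ℕ} (Ω : Set (EuclideanSpace ℝ (Fin n))) (s p : ℝ)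
    (u : EuclideanSpace ℝ (Fin n) → ℝ) : Prop where
  aemeasurable : AEMeasurable u volume
  memLp : MemLp u (ENNReal.ofReal p) (volume.restrict Ω)
  memLp_quotient : MemLp
    (fun z : EuclideanSpace ℝ (Fin n) × EuclideanSpace ℝ (Fin n) =>
      (u z.1 - u z.2) / ‖z.1 - z.2‖ ^ (((n : ℝ) + s * p) / p))
    (ENNReal.ofReal p) (volume.restrict (Q Ω))

/-- The space `X₀`: the functions in `X` that vanish a.e. outside `Ω`. -/
structure MemX0 {n : ℕ} (Ω : Set (EuclideanSpace ℝ (Fin n))) (s p : ℝ)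
    (u : EuclideanSpace ℝ (Fin n) → ℝ) : Prop where
  memX : MemX Ω s p u
  eq_zero : ∀ᵐ x ∂(volume : Measure (EuclideanSpace ℝ (Fin n))), x ∉ Ω → u x = 0

/-- The class `C_c^∞(Ω)` of test functions, extended by zero to `ℝⁿ`. -/
structure IsTestFunction {n : ℕ} (Ω : Set (EuclideanSpace ℝ (Fin n)))
    (ψ : EuclideanSpace ℝ (Fin n) → ℝ) : Prop where
  contDiff : ContDiff ℝ ∞ ψ
  hasCompactSupport : HasCompactSupport ψ
  tsupport_subset : tsupport ψ ⊆ Ω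

/-- The weak form of the fractional `p`-Laplacian,
`∫_Q |u(x)-u(y)|^(p-2) (u(x)-u(y)) (ψ(x)-ψ(y)) / |x-y|^(n+sp) dx dy`.
By Hölder's inequality the integrand is integrable whenever `u` and `ψ` are in `X₀`. -/
noncomputable def weakForm {n : ℕ} (Ω : Set (EuclideanSpace ℝ (Fin n))) (s p : ℝ)
    (u ψ : EuclideanSpace ℝ (Fin n) → ℝ) : ℝ :=
  ∫ z : EuclideanSpace ℝ (Fin n) × EuclideanSpace ℝ (Fin n) in Q Ω,
    |u z.1 - u z.2| ^ (p - 2) * (u z.1 - u z.2) * (ψ z.1 - ψ z.2) /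
      ‖z.1 - z.2‖ ^ ((n : ℝ) + s * p)

/-- `u` is a positive weak solution of
`(-Δ_p)^s u = lam u^(-q) + u^α`, `u > 0` in `Ω`, `u = 0` in `ℝⁿ \ Ω`. The right-hand side tested
against `ψ` is required to be an honest (convergent) integral. -/
structure IsPositiveWeakSolution {n : ℕ} (Ω : Set (EuclideanSpace ℝ (Fin n)))
    (s p lam q α : ℝ) (u : EuclideanSpace ℝ (Fin n) → ℝ) : Prop where
  memX0 : MemX0 Ω s p u
  pos : ∀ᵐ x ∂(volume : Measure (EuclideanSpace ℝ (Fin n))), x ∈ Ω → 0 < u x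
  integrableOn : ∀ ψ : EuclideanSpace ℝ (Fin n) → ℝ, IsTestFunction Ω ψ →
    IntegrableOn (fun x => (lam * u x ^ (-q) + u x ^ α) * ψ x) Ω volume
  weak_eq : ∀ ψ : EuclideanSpace ℝ (Fin n) → ℝ, IsTestFunction Ω ψ →
    weakForm Ω s p u ψ - ∫ x in Ω, (lam * u x ^ (-q) + u x ^ α) * ψ x = 0

end FracPLap

/-!
# Boundedness of weak solutions of a singular fractional `p`-Laplace equation

Write `d = n`, `σ = sp`, `β = d / (d - σ)`, so that `p*_s = pβ`. On `{u ≥ 1}` the right-hand side is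
at most `(λ + 1) u^(p*_s - 1)`, and the solution is bounded because of De Giorgi's iteration on the
masses `A(c) = ∫ ((u - c)_+)^(p*_s)`, which works directly at the critical growth:

* testing with `(u - c)_+` gives `[(u - c)_+]^p ≤ ∫ f (u - c)_+` (`gagliardo_posPart_le`);
* for `1 ≤ c' < c`, on `{u > c}` one has `u ≤ c / (c - c') (u - c')`, so the right-hand side is at
  most `(λ + 1) (c / (c - c'))^(p*_s - 1) A(c')`;
* the fractional Sobolev inequality (`exists_sobolev`) turns this into
  `A(c) ≤ (C (c / (c - c'))^(p*_s - 1) A(c'))^β` with `β > 1`.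

The constants depend on the levels through the ratio `c / (c - c')` only. Along the levels
`M (2 - 2^(-k))` they therefore do not depend on `M`, while `A(M) → 0` as `M → ∞` since
`u ∈ L^(p*_s)`; so for large `M` the recursion forces `A(2M) = 0`
(`exists_eq_zero_of_level_recursion`).

The Sobolev inequality has a short proof: if `m = ∫ w^(p*_s)` is finite, Chebyshev's inequality
yields a ball around `x`, of radius comparable to `(m / w(x)^(p*_s))^(1/d)`, on half of which
`w ≤ w(x)/2`; this bounds `∫ |w(x) - w(y)|^p / |x - y|^(d+σ) dy` from below by a multiple of
`w(x)^(p*_s) m^(-σ/d)`, and one integrates in `x`.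

The function `(u - c)_+` is not a test function. Mollification extends the equation to bounded
functions of finite energy with compact support in `Ω` (`weak_eq_of_isCompact`). A cutoff at
distance `1/k` from the complement then gives the inequality for `(u - c)_+`; the cutoffs stay
dominated thanks to a fractional Hardy inequality (`hardy_lintegral_ne_top`), valid since the smooth
boundary provides exterior balls of comparable size at every scale (`exists_exteriorCorkscrew`).
-/

namespace FracPLap

open Metric Filter Topology
open scoped ENNReal Convolution

/-! ### Exterior corkscrews of smooth domains -/

section Geometry

variable {E : Type*} [NormedAddCommGroup E] [NormedSpace ℝ E]

/-- The uniform exterior corkscrew condition: every point `x ∈ Ω` sees, at distance comparable to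
its distance `infDist x Ωᶜ` to the complement, a ball of comparable radius outside `Ω`. -/
def ExteriorCorkscrew (Ω : Set E) (ε R : ℝ) : Prop :=
  ∀ x ∈ Ω, ∃ z, ball z (ε * infDist x Ωᶜ) ⊆ Ωᶜ ∧
    ball z (ε * infDist x Ωᶜ) ⊆ ball x (R * infDist x Ωᶜ)

/-- Local corkscrew balls at scales below a fixed `t₀`: move from `y ∉ Ω` in a direction along
which the defining function strictly increases. -/
theorem exists_local_corkscrew {Ω U : Set E} {ρ : E → ℝ} {x₀ : E} (hU : U ∈ 𝓝 x₀)
    {L : E →L[ℝ] ℝ} (hρ : HasStrictFDerivAt ρ L x₀) (hL : L ≠ 0)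
    (hΩ : Ω ∩ U = {y ∈ U | ρ y < 0}) :
    ∃ V ∈ 𝓝 x₀, ∃ t₀ > 0, ∃ ε > 0, ∃ R > 0, ∀ y ∈ V, y ∉ Ω → ∀ t, 0 < t → t < t₀ →
      ∃ z, ball z (ε * t) ⊆ Ωᶜ ∧ ball z (ε * t) ⊆ ball y (R * t) := by
  obtain ⟨v, hv⟩ : ∃ v, L v = 1 := by
    obtain ⟨w, hw⟩ : ∃ w, L w ≠ 0 := by
      by_contra! h
      exact hL (ContinuousLinearMap.ext h)
    exact ⟨(L w)⁻¹ • w, by simp [hw]⟩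
  set A := ‖v‖ + 1 with hA
  have hA0 : 0 < A := by positivity
  have hc : (0 : ℝ) < 1 / (4 * A) := by positivity
  have h1 := hρ.isLittleO.def hc
  rw [nhds_prod_eq] at h1
  obtain ⟨W, hW, hW'⟩ := (Filter.eventually_prod_self_iff
    (r := fun a b => ‖ρ a - ρ b - L (a - b)‖ ≤ 1 / (4 * A) * ‖a - b‖)).1 h1
  obtain ⟨δ, hδ, hδW⟩ := Metric.mem_nhds_iff.1 (Filter.inter_mem hW hU)
  set ε := 1 / (2 * (‖L‖ + 1)) with hε
  have hε0 : 0 < ε := by positivity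
  have hε1 : ε ≤ 1 := by
    rw [hε, div_le_one (by positivity)]
    linarith [norm_nonneg L]
  have hLε : ‖L‖ * ε ≤ 1 / 2 := by
    rw [hε, mul_one_div, div_le_div_iff₀ (by positivity) (by norm_num)]
    linarith [norm_nonneg L]
  refine ⟨ball x₀ (δ / 2), ball_mem_nhds _ (by positivity), δ / (2 * A), by positivity, ε, hε0,
    A, hA0, ?_⟩
  intro y hy hyΩ t ht htt
  have hnorm : ∀ a ∈ ball (y + t • v) (ε * t), ‖a - y - t • v‖ < ε * t ∧ ‖a - y‖ < A * t := by
    intro a ha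
    have h2 : ‖a - y - t • v‖ < ε * t := by
      rw [mem_ball, dist_eq_norm] at ha
      rwa [sub_sub]
    refine ⟨h2, ?_⟩
    calc ‖a - y‖ = ‖(a - y - t • v) + t • v‖ := by simp
      _ ≤ ‖a - y - t • v‖ + ‖t • v‖ := norm_add_le _ _
      _ < ε * t + t * ‖v‖ := by
          rw [norm_smul, Real.norm_of_nonneg ht.le]
          linarith
      _ ≤ A * t := by
          rw [hA]; nlinarith
  refine ⟨y + t • v, fun a ha => ?_, fun a ha => ?_⟩
  · obtain ⟨h2, h3⟩ := hnorm a ha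
    have hAt : A * t < δ / 2 := by
      rw [lt_div_iff₀ (by positivity)] at htt
      linarith
    have hyδ : y ∈ ball x₀ δ := ball_subset_ball (by linarith) hy
    have haδ : a ∈ ball x₀ δ := by
      rw [mem_ball] at hy ⊢
      have : dist a y < A * t := by rwa [dist_eq_norm]
      linarith [dist_triangle a y x₀]
    have hρy : 0 ≤ ρ y := by
      by_contra! h
      have : y ∈ Ω ∩ U := by rw [hΩ]; exact ⟨(hδW hyδ).2, h⟩
      exact hyΩ this.1
    have h4 : |ρ a - ρ y - L (a - y)| ≤ 1 / (4 * A) * ‖a - y‖ :=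
      hW' a (hδW haδ).1 y (hδW hyδ).1
    have h5 : 1 / (4 * A) * ‖a - y‖ ≤ t / 4 := by
      rw [one_div_mul_eq_div, div_le_iff₀ (by positivity)]
      nlinarith
    have h6 : L (a - y) = L (a - y - t • v) + t := by simp [hv]
    have h7 : |L (a - y - t • v)| ≤ t / 2 := by
      calc |L (a - y - t • v)| ≤ ‖L‖ * ‖a - y - t • v‖ := L.le_opNorm _
        _ ≤ ‖L‖ * (ε * t) := by gcongr
        _ ≤ t / 2 := by nlinarith
    have h8 : 0 < ρ a := by
      have := abs_le.1 (h4.trans h5)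
      have := abs_le.1 h7
      linarith
    intro haΩ
    have : a ∈ Ω ∩ U := ⟨haΩ, (hδW haδ).2⟩
    rw [hΩ] at this
    exact absurd this.2 (not_lt.2 h8.le)
  · rw [mem_ball, dist_eq_norm]
    exact (hnorm a ha).2

theorem exists_uniform_corkscrew {E : Type*} [NormedAddCommGroup E] {Ω K : Set E} (hK : IsCompact K)
    (h : ∀ x₀ ∈ K, ∃ V ∈ 𝓝 x₀, ∃ t₀ > 0, ∃ ε > 0, ∃ R > 0, ∀ y ∈ V, y ∉ Ω →
      ∀ t, 0 < t → t < t₀ →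
      ∃ z, ball z (ε * t) ⊆ Ωᶜ ∧ ball z (ε * t) ⊆ ball y (R * t)) :
    ∃ t₀ : ℝ, 0 < t₀ ∧ ∃ ε : ℝ, 0 < ε ∧ ∃ R : ℝ, 0 < R ∧ ∀ y ∈ K, y ∉ Ω →
      ∀ t, 0 < t → t < t₀ → ∃ z, ball z (ε * t) ⊆ Ωᶜ ∧ ball z (ε * t) ⊆ ball y (R * t) := by
  refine hK.induction_on (p := fun K => ∃ t₀ : ℝ, 0 < t₀ ∧ ∃ ε : ℝ, 0 < ε ∧ ∃ R : ℝ, 0 < R ∧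
    ∀ y ∈ K, y ∉ Ω → ∀ t, 0 < t → t < t₀ →
      ∃ z, ball z (ε * t) ⊆ Ωᶜ ∧ ball z (ε * t) ⊆ ball y (R * t)) ?_ ?_ ?_ ?_
  · exact ⟨1, one_pos, 1, one_pos, 1, one_pos, by simp⟩
  · rintro s t hst ⟨t₀, ht₀, ε, hε, R, hR, H⟩
    exact ⟨t₀, ht₀, ε, hε, R, hR, fun y hy => H y (hst hy)⟩
  · rintro s s' ⟨t₀, ht₀, ε, hε, R, hR, H⟩ ⟨t₁, ht₁, ε', hε', R', hR', H'⟩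
    refine ⟨min t₀ t₁, lt_min ht₀ ht₁, min ε ε', lt_min hε hε', max R R', lt_max_of_lt_left hR, ?_⟩
    rintro y (hy | hy) hyΩ t ht htt
    · obtain ⟨z, h1, h2⟩ := H y hy hyΩ t ht (htt.trans_le (min_le_left _ _))
      have h3 : ball z (min ε ε' * t) ⊆ ball z (ε * t) :=
        ball_subset_ball (by gcongr; exact min_le_left _ _)
      exact ⟨z, h3.trans h1, (h3.trans h2).trans
        (ball_subset_ball (by gcongr; exact le_max_left _ _))⟩
    · obtain ⟨z, h1, h2⟩ := H' y hy hyΩ t ht (htt.trans_le (min_le_right _ _))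
      have h3 : ball z (min ε ε' * t) ⊆ ball z (ε' * t) :=
        ball_subset_ball (by gcongr; exact min_le_right _ _)
      exact ⟨z, h3.trans h1, (h3.trans h2).trans
        (ball_subset_ball (by gcongr; exact le_max_right _ _))⟩
  · intro x hx
    obtain ⟨V, hV, t₀, ht₀, ε, hε, R, hR, H⟩ := h x hx
    exact ⟨V, mem_nhdsWithin_of_mem_nhds hV, t₀, ht₀, ε, hε, R, hR, H⟩

theorem nonempty_compl_of_isBounded [Nontrivial E] {Ω : Set E} (hb : Bornology.IsBounded Ω) :
    Ωᶜ.Nonempty := by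
  rw [Set.nonempty_compl]
  rintro rfl
  exact NormedSpace.unbounded_univ ℝ E hb

theorem infDist_compl_pos [Nontrivial E] {Ω : Set E} (ho : IsOpen Ω)
    (hb : Bornology.IsBounded Ω) {x : E} (hx : x ∈ Ω) : 0 < infDist x Ωᶜ :=
  (ho.isClosed_compl.notMem_iff_infDist_pos (nonempty_compl_of_isBounded hb)).1 (by simpa using hx)

theorem exists_exteriorCorkscrew [FiniteDimensional ℝ E] [Nontrivial E] {Ω : Set E} (ho : IsOpen Ω)
    (hb : Bornology.IsBounded Ω)
    (hsm : ∀ x ∈ frontier Ω, ∃ (U : Set E) (ρ : E → ℝ), IsOpen U ∧ x ∈ U ∧ ContDiffOn ℝ ∞ ρ U ∧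
      fderiv ℝ ρ x ≠ 0 ∧ Ω ∩ U = {y ∈ U | ρ y < 0}) :
    ∃ ε > 0, ∃ R > 0, ExteriorCorkscrew Ω ε R := by
  have hne := nonempty_compl_of_isBounded hb
  have hfr : IsCompact (frontier Ω) :=
    isCompact_of_isClosed_isBounded isClosed_frontier (hb.closure.subset frontier_subset_closure)
  obtain ⟨t₀, ht₀, ε, hε, R, hR, H⟩ := exists_uniform_corkscrew (Ω := Ω) hfr (by
    intro x₀ hx₀
    obtain ⟨U, ρ, hU, hxU, hρ, hd, hΩ⟩ := hsm x₀ hx₀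
    have hUn := hU.mem_nhds hxU
    exact exists_local_corkscrew hUn
      ((hρ.contDiffAt hUn).hasStrictFDerivAt (by simp)) hd hΩ)
  obtain ⟨y₀, hy₀⟩ := hne
  obtain ⟨D, hD⟩ := hb.subset_closedBall y₀
  have hdD : ∀ x ∈ Ω, infDist x Ωᶜ ≤ |D| := fun x hx =>
    (infDist_le_dist_of_mem hy₀).trans ((mem_closedBall.1 (hD hx)).trans (le_abs_self D))
  set κ := t₀ / (|D| + 1) with hκ
  have hκ0 : 0 < κ := by positivity
  refine ⟨ε * κ, by positivity, R * κ + 1, by positivity, fun x hx => ?_⟩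
  have hd := infDist_compl_pos ho hb hx
  obtain ⟨y, hy, hxy⟩ := ho.isClosed_compl.exists_infDist_eq_dist ⟨y₀, hy₀⟩ x
  -- The open ball of radius `dist(x, Ωᶜ)` lies in `Ω`, so its closure, which contains the nearest
  -- point `y ∉ Ω`, lies in the closure of `Ω`.
  have hyf : y ∈ frontier Ω := by
    refine ⟨?_, by rwa [ho.interior_eq]⟩
    have h1 : y ∈ closedBall x (infDist x Ωᶜ) := by rw [mem_closedBall, dist_comm, hxy]
    rw [← closure_ball x hd.ne'] at h1
    exact closure_mono (ball_infDist_compl_subset) h1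
  obtain ⟨z, h1, h2⟩ := H y hyf hy (κ * infDist x Ωᶜ) (by positivity) (by
    rw [hκ, div_mul_eq_mul_div, div_lt_iff₀ (by positivity)]
    have := hdD x hx
    gcongr
    linarith)
  refine ⟨z, by rwa [mul_assoc], ?_⟩
  rw [mul_assoc ε]
  refine h2.trans fun a ha => ?_
  rw [mem_ball] at ha ⊢
  calc dist a x ≤ dist a y + dist x y := by rw [dist_comm x y]; exact dist_triangle _ _ _
    _ < R * (κ * infDist x Ωᶜ) + infDist x Ωᶜ := by rw [← hxy]; linarith
    _ = _ := by ring

end Geometry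

/-! ### The fractional Sobolev inequality -/

section Sobolev

variable {E : Type*} [NormedAddCommGroup E] [NormedSpace ℝ E] [FiniteDimensional ℝ E]
  [MeasurableSpace E] [BorelSpace E]

/-- The Gagliardo energy `∬ |w(x) - w(y)|^p / |x - y|^κ dx dy`; with `κ = n + sp` it is the `p`-th
power of the `W^{s,p}` seminorm. -/
noncomputable def gagliardo (μ : Measure E) (κ p : ℝ) (w : E → ℝ) : ℝ≥0∞ :=
  ∫⁻ z : E × E, ENNReal.ofReal (|w z.1 - w z.2| ^ p / ‖z.1 - z.2‖ ^ κ) ∂(μ.prod μ)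

theorem measurable_gagliardo_integrand {κ p : ℝ} {w : E → ℝ} (hw : Measurable w) :
    Measurable fun z : E × E => |w z.1 - w z.2| ^ p / ‖z.1 - z.2‖ ^ κ := by
  have h1 : Measurable fun z : E × E => w z.1 - w z.2 :=
    (hw.comp measurable_fst).sub (hw.comp measurable_snd)
  have h2 : Measurable fun z : E × E => ‖z.1 - z.2‖ :=
    (continuous_fst.sub continuous_snd).norm.measurable
  have h3 : Measurable fun z : E × E => |w z.1 - w z.2| := by
    simpa only [Real.norm_eq_abs] using h1.norm
  exact (h3.pow_const p).div (h2.pow_const κ)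

theorem gagliardo_mono {E : Type*} [NormedAddCommGroup E] [MeasurableSpace E]
    {μ : Measure E} {κ p : ℝ} (hp : 0 ≤ p) {v w : E → ℝ}
    (h : ∀ x y, |v x - v y| ≤ |w x - w y|) : gagliardo μ κ p v ≤ gagliardo μ κ p w := by
  refine lintegral_mono fun z => ENNReal.ofReal_le_ofReal ?_
  exact div_le_div_of_nonneg_right (Real.rpow_le_rpow (abs_nonneg _) (h _ _) hp) (by positivity)

variable (μ : Measure E) [μ.IsAddHaarMeasure]

/-- If the ball `B_r(x)` has twice the measure that Chebyshev's inequality allows for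
`{w ≥ w(x)/2}`, then `w ≤ w(x)/2` on at least half of it. -/
theorem ofReal_mul_le_lintegral_of_half {κ p q : ℝ} (hκ : 0 ≤ κ) (hp : 0 ≤ p) (hq : 0 < q)
    {w : E → ℝ} (hw : Measurable w)
    (hm : ∫⁻ x, ENNReal.ofReal (w x ^ q) ∂μ ≠ ⊤) {x : E} (hx : 0 < w x) {r : ℝ} (hr : 0 < r)
    (hr' : 2 * (2 ^ q * (∫⁻ x, ENNReal.ofReal (w x ^ q) ∂μ).toReal / w x ^ q) =
      μ.real (ball x r)) :
    ENNReal.ofReal ((w x / 2) ^ p / r ^ κ * (μ.real (ball x r) / 2)) ≤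
      ∫⁻ y, ENNReal.ofReal (|w x - w y| ^ p / ‖x - y‖ ^ κ) ∂μ := by
  set m := ∫⁻ x, ENNReal.ofReal (w x ^ q) ∂μ with hmdef
  set S := ball x r ∩ {y | w y ≤ w x / 2} with hS
  have hSm : MeasurableSet S := measurableSet_ball.inter (measurableSet_le hw measurable_const)
  set T := {y | w x / 2 ≤ w y} with hT
  have hTfin : ENNReal.ofReal ((w x / 2) ^ q) * μ T ≤ m := by
    calc ENNReal.ofReal ((w x / 2) ^ q) * μ T
        ≤ ENNReal.ofReal ((w x / 2) ^ q) *
          μ {y | ENNReal.ofReal ((w x / 2) ^ q) ≤ ENNReal.ofReal (w y ^ q)} := by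
          refine mul_le_mul_right (measure_mono fun y hy => ?_) _
          have hy' : w x / 2 ≤ w y := hy
          exact ENNReal.ofReal_le_ofReal (by gcongr)
      _ ≤ m := mul_meas_ge_le_lintegral (hw.pow_const q).ennreal_ofReal _
  have hhalf : 0 < (w x / 2) ^ q := by positivity
  have hTne : μ T ≠ ⊤ := by
    intro h
    rw [h, ENNReal.mul_top (by simpa using hhalf.not_ge)] at hTfin
    exact hm (top_le_iff.1 hTfin)
  have hTreal : μ.real T ≤ μ.real (ball x r) / 2 := by
    have h1 := ENNReal.toReal_mono hm hTfin
    rw [ENNReal.toReal_mul, ENNReal.toReal_ofReal hhalf.le] at h1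
    rw [← hr', mul_div_cancel_left₀ _ (two_ne_zero), le_div_iff₀ (by positivity)]
    rw [Real.div_rpow hx.le (by norm_num), div_mul_eq_mul_div, div_le_iff₀ (by positivity)] at h1
    calc μ.real T * w x ^ q = w x ^ q * μ.real T := mul_comm _ _
      _ ≤ m.toReal * 2 ^ q := h1
      _ = _ := mul_comm _ _
  have hSreal : μ.real (ball x r) / 2 ≤ μ.real S := by
    have hsub : ball x r ⊆ S ∪ T := by
      intro y hy
      rcases le_total (w y) (w x / 2) with h | h
      · exact Or.inl ⟨hy, h⟩
      · exact Or.inr h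
    have hSne : μ S ≠ ⊤ := ((measure_mono Set.inter_subset_left).trans_lt measure_ball_lt_top).ne
    have h1 : μ.real (ball x r) ≤ μ.real S + μ.real T :=
      (measureReal_mono hsub (measure_union_ne_top hSne hTne)).trans (measureReal_union_le _ _)
    linarith
  calc ENNReal.ofReal ((w x / 2) ^ p / r ^ κ * (μ.real (ball x r) / 2))
      ≤ ENNReal.ofReal ((w x / 2) ^ p / r ^ κ) * μ S := by
        rw [ENNReal.ofReal_mul (by positivity)]
        gcongr
        exact ENNReal.ofReal_le_of_le_toReal hSreal
    _ = ∫⁻ y in S, ENNReal.ofReal ((w x / 2) ^ p / r ^ κ) ∂μ := by rw [setLIntegral_const]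
    _ ≤ ∫⁻ y in S, ENNReal.ofReal (|w x - w y| ^ p / ‖x - y‖ ^ κ) ∂μ := by
        refine setLIntegral_mono' hSm fun y hy => ENNReal.ofReal_le_ofReal ?_
        have h2 : w y ≤ w x / 2 := hy.2
        have h3 : ‖x - y‖ ≤ r := by
          have := hy.1
          rw [mem_ball, dist_comm, dist_eq_norm] at this
          exact this.le
        have h4 : 0 < ‖x - y‖ := by
          rw [norm_pos_iff, sub_ne_zero]
          rintro rfl
          linarith
        have h5 : w x / 2 ≤ |w x - w y| := le_trans (by linarith) (le_abs_self _)
        gcongr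
    _ ≤ _ := setLIntegral_le_lintegral _ _

/-- The pointwise form of the fractional Sobolev inequality, for `q = dp/(d-σ)`. If `‖w‖_q` is
finite then `{w > w(x)/2}` fills at most half of a ball around `x` of suitable radius, and the
other half bounds `∫ |w(x) - w(y)|^p / |x - y|^(d+σ) dy` from below. -/
theorem exists_rpow_le_lintegral [Nontrivial E] {d σ p q : ℝ}
    (hd : d = Module.finrank ℝ E) (hσ : 0 ≤ σ) (hp : 0 < p) (hq : 0 < q)
    (hpq : q * (1 - σ / d) = p) :
    ∃ C : ℝ, 0 < C ∧ ∀ w : E → ℝ, Measurable w → (∀ x, 0 ≤ w x) →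
      ∫⁻ x, ENNReal.ofReal (w x ^ q) ∂μ ≠ ⊤ → ∫⁻ x, ENNReal.ofReal (w x ^ q) ∂μ ≠ 0 → ∀ x,
      ENNReal.ofReal (w x ^ q) ≤
        ENNReal.ofReal (C * (∫⁻ x, ENNReal.ofReal (w x ^ q) ∂μ).toReal
          ^ (σ / d)) *
        ∫⁻ y, ENNReal.ofReal (|w x - w y| ^ p / ‖x - y‖ ^ (d + σ)) ∂μ := by
  have hd0 : 0 < d := by
    rw [hd]; exact_mod_cast Module.finrank_pos
  set b := μ.real (ball (0 : E) 1) with hb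
  have hb0 : 0 < b := ENNReal.toReal_pos (measure_ball_pos μ _ one_pos).ne' measure_ball_lt_top.ne
  refine ⟨2 ^ (p + 1) / b * (2 ^ (q + 1) / b) ^ (σ / d), by positivity, ?_⟩
  intro w hw hw0 hm hm0 x
  set m := (∫⁻ x, ENNReal.ofReal (w x ^ q) ∂μ).toReal with hmdef
  have hmpos : 0 < m := ENNReal.toReal_pos hm0 hm
  rcases (hw0 x).eq_or_lt with hx | hx
  · rw [← hx, Real.zero_rpow hq.ne']
    simp
  -- The radius makes the measure of the ball twice the Chebyshev bound for `{w ≥ w x / 2}`.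
  set X := 2 ^ (q + 1) / b * m / w x ^ q with hX
  have hX0 : 0 < X := by positivity
  set r := X ^ (1 / d) with hr
  have hr0 : 0 < r := by positivity
  have hball : μ.real (ball x r) = X * b := by
    rw [measureReal_def, Measure.addHaar_ball μ x hr0.le, ENNReal.toReal_mul,
      ENNReal.toReal_ofReal (by positivity), ← measureReal_def, hr, ← Real.rpow_natCast,
      ← Real.rpow_mul hX0.le, ← hd, one_div_mul_cancel hd0.ne', Real.rpow_one]
  have key := ofReal_mul_le_lintegral_of_half μ (κ := d + σ) (by positivity) hp.le hq hw hm hx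
    hr0 (by
      rw [hball, hX, Real.rpow_add_one (by norm_num)]
      field_simp
      exact hmdef.symm)
  have hrκ : r ^ (d + σ) = X * X ^ (σ / d) := by
    rw [hr, ← Real.rpow_mul hX0.le, ← Real.rpow_one_add' hX0.le (by positivity)]
    congr 1
    field_simp
  have hXσ : X ^ (σ / d) = (2 ^ (q + 1) / b) ^ (σ / d) * m ^ (σ / d) / w x ^ (q * (σ / d)) := by
    rw [hX, Real.div_rpow (by positivity) (by positivity), Real.mul_rpow (by positivity) hmpos.le,
      ← Real.rpow_mul hx.le]
  have hwq : w x ^ q = w x ^ p * w x ^ (q * (σ / d)) := by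
    rw [← Real.rpow_add hx]
    congr 1
    linarith
  calc ENNReal.ofReal (w x ^ q)
      = ENNReal.ofReal (2 ^ (p + 1) / b * (2 ^ (q + 1) / b) ^ (σ / d) * m ^ (σ / d)) *
        ENNReal.ofReal ((w x / 2) ^ p / r ^ (d + σ) * (μ.real (ball x r) / 2)) := by
        rw [← ENNReal.ofReal_mul (by positivity)]
        congr 1
        rw [hball, hrκ, hXσ, hwq, Real.div_rpow hx.le (by norm_num),
          Real.rpow_add_one (by norm_num)]
        field_simp
    _ ≤ _ := by gcongr

theorem lintegral_gagliardo_eq {κ p : ℝ} {w : E → ℝ} (hw : Measurable w) :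
    gagliardo μ κ p w =
      ∫⁻ x, ∫⁻ y, ENNReal.ofReal (|w x - w y| ^ p / ‖x - y‖ ^ κ) ∂μ ∂μ :=
  lintegral_prod _ (measurable_gagliardo_integrand hw).ennreal_ofReal.aemeasurable

/-- The fractional Sobolev inequality for functions whose `L^{p*}` norm is already known to be
finite, where `β = d/(d-σ)` and `p* = pβ`. -/
theorem exists_sobolev_of_finite [Nontrivial E] {d σ p β : ℝ}
    (hd : d = Module.finrank ℝ E) (hσ : 0 ≤ σ) (hp : 0 < p)
    (hβ : 0 < β) (hβσ : β * (1 - σ / d) = 1) :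
    ∃ C : ℝ, 0 < C ∧ ∀ w : E → ℝ, Measurable w → (∀ x, 0 ≤ w x) →
      ∫⁻ x, ENNReal.ofReal (w x ^ (p * β)) ∂μ ≠ ⊤ →
      gagliardo μ (d + σ) p w ≠ ⊤ →
      ∫⁻ x, ENNReal.ofReal (w x ^ (p * β)) ∂μ ≤
        ENNReal.ofReal ((C * (gagliardo μ (d + σ) p w).toReal) ^ β) := by
  obtain ⟨C, hC, H⟩ := exists_rpow_le_lintegral μ (p := p) (q := p * β) hd hσ hp
    (by positivity) (by rw [mul_assoc, hβσ, mul_one])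
  refine ⟨C, hC, fun w hw hw0 hm hE => ?_⟩
  rcases eq_or_ne (∫⁻ x, ENNReal.ofReal (w x ^ (p * β)) ∂μ) 0 with h0 | h0
  · rw [h0]; exact zero_le
  have h1 := lintegral_mono (μ := μ) (H w hw hw0 hm h0)
  rw [lintegral_const_mul' _ _ ENNReal.ofReal_ne_top, ← lintegral_gagliardo_eq μ hw] at h1
  set m := (∫⁻ x, ENNReal.ofReal (w x ^ (p * β)) ∂μ).toReal with hmdef
  have hmpos : 0 < m := ENNReal.toReal_pos h0 hm
  have h2 : m ≤ C * m ^ (σ / d) *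
      (gagliardo μ (d + σ) p w).toReal := by
    have := ENNReal.toReal_mono (ENNReal.mul_ne_top ENNReal.ofReal_ne_top hE) h1
    rwa [ENNReal.toReal_mul, ENNReal.toReal_ofReal (by positivity)] at this
  rw [ENNReal.le_ofReal_iff_toReal_le hm (by positivity)]
  have h3 : m ^ (1 - σ / d) ≤
      C * (gagliardo μ (d + σ) p w).toReal := by
    rw [Real.rpow_sub hmpos, Real.rpow_one, div_le_iff₀ (by positivity)]
    linarith
  calc m = (m ^ (1 - σ / d)) ^ β := by
        rw [← Real.rpow_mul hmpos.le, mul_comm, hβσ, Real.rpow_one]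
    _ ≤ _ := by gcongr

/-- The fractional Sobolev inequality: truncate at height `k` and let `k → ∞`. -/
theorem exists_sobolev [Nontrivial E] {d σ p β : ℝ}
    (hd : d = Module.finrank ℝ E) (hσ : 0 ≤ σ) (hp : 0 < p)
    (hβ : 0 < β) (hβσ : β * (1 - σ / d) = 1) :
    ∃ C : ℝ, 0 < C ∧ ∀ w : E → ℝ, Measurable w → (∀ x, 0 ≤ w x) →
      ∀ A : Set E, (∀ x ∉ A, w x = 0) → μ A ≠ ⊤ →
      gagliardo μ (d + σ) p w ≠ ⊤ →
      ∫⁻ x, ENNReal.ofReal (w x ^ (p * β)) ∂μ ≤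
        ENNReal.ofReal ((C * (gagliardo μ (d + σ) p w).toReal) ^ β) := by
  obtain ⟨C, hC, H⟩ := exists_sobolev_of_finite μ hd hσ hp hβ hβσ
  refine ⟨C, hC, fun w hw hw0 A hA hμA hE => ?_⟩
  have hq : 0 < p * β := by positivity
  set wk : ℕ → E → ℝ := fun k x => min (w x) k with hwk
  have hwk0 : ∀ k x, 0 ≤ wk k x := fun k x => le_min (hw0 x) (Nat.cast_nonneg k)
  have hwkm : ∀ k, Measurable (wk k) := fun k => hw.min measurable_const
  have hmono : ∀ k, gagliardo μ (d + σ) p (wk k) ≤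
      gagliardo μ (d + σ) p w := fun k =>
    gagliardo_mono hp.le fun x y => by
      simpa using abs_min_sub_min_le_max (w x) (k : ℝ) (w y) k
  have hbound : ∀ k, ∫⁻ x, ENNReal.ofReal (wk k x ^ (p * β)) ∂μ ≤
      ENNReal.ofReal ((C * (gagliardo μ (d + σ) p w).toReal) ^ β) := by
    intro k
    refine (H (wk k) (hwkm k) (hwk0 k) ?_ (ne_top_of_le_ne_top hE (hmono k))).trans ?_
    · refine ne_top_of_le_ne_top (b := ENNReal.ofReal ((k : ℝ) ^ (p * β)) * μ (toMeasurable μ A))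
        (ENNReal.mul_ne_top ENNReal.ofReal_ne_top (by rwa [measure_toMeasurable])) ?_
      rw [← lintegral_indicator_const (measurableSet_toMeasurable μ A)]
      refine lintegral_mono fun x => ?_
      by_cases hx : x ∈ toMeasurable μ A
      · rw [Set.indicator_of_mem hx]
        refine ENNReal.ofReal_le_ofReal (Real.rpow_le_rpow (hwk0 k x) (min_le_right _ _) hq.le)
      · have : w x = 0 := hA x fun h => hx (subset_toMeasurable μ A h)
        simp [hwk, this, Real.zero_rpow hq.ne']
    · gcongr
      exact hmono k
  have hlim : ∀ x, Tendsto (fun k => ENNReal.ofReal (wk k x ^ (p * β))) atTop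
      (𝓝 (ENNReal.ofReal (w x ^ (p * β)))) := by
    intro x
    refine tendsto_const_nhds.congr' ?_
    filter_upwards [eventually_ge_atTop ⌈w x⌉₊] with k hk
    have : w x ≤ k := (Nat.le_ceil _).trans (by exact_mod_cast hk)
    simp [hwk, this]
  calc ∫⁻ x, ENNReal.ofReal (w x ^ (p * β)) ∂μ
      = ∫⁻ x, liminf (fun k => ENNReal.ofReal (wk k x ^ (p * β))) atTop ∂μ := by
        simp_rw [fun x => (hlim x).liminf_eq]
    _ ≤ liminf (fun k => ∫⁻ x, ENNReal.ofReal (wk k x ^ (p * β)) ∂μ) atTop :=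
        lintegral_liminf_le fun k => ((hwkm k).pow_const _).ennreal_ofReal
    _ ≤ _ := liminf_le_of_le (by isBoundedDefault) (fun b hb => by
        obtain ⟨k, hk⟩ := hb.exists
        exact hk.trans (hbound k))

end Sobolev

/-! ### De Giorgi's iteration lemma -/

section DeGiorgi

/-- Fast geometric convergence: a superlinear recursion drives a small enough start to zero. -/
theorem exists_pos_tendsto_zero_of_recursion {C B β : ℝ} (hC : 0 < C) (hB : 1 < B) (hβ : 1 < β) :
    ∃ δ > 0, ∀ a : ℕ → ℝ, (∀ k, 0 ≤ a k) → (∀ k, a (k + 1) ≤ (C * B ^ k * a k) ^ β) →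
      a 0 ≤ δ → Tendsto a atTop (𝓝 0) := by
  have hB0 : 0 < B := by linarith
  have hβ1 : 0 < β - 1 := by linarith
  -- The ansatz `a k ≤ δ θ ^ k` closes up for these choices of `θ` and `δ`.
  set θ := B ^ (-(β / (β - 1))) with hθ
  have hθ0 : 0 < θ := by positivity
  have hθ1 : θ < 1 := Real.rpow_lt_one_of_one_lt_of_neg hB (by
    rw [neg_lt_zero]; positivity)
  have hBθ : (B * θ) ^ β = θ := by
    rw [hθ]
    nth_rewrite 1 [← Real.rpow_one B]
    rw [← Real.rpow_add hB0, ← Real.rpow_mul hB0.le]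
    congr 1
    field_simp
    ring
  set δ := (θ / C ^ β) ^ (1 / (β - 1)) with hδ
  have hδ0 : 0 < δ := by positivity
  have hCδ : (C * δ) ^ β = θ * δ := by
    have h1 : δ ^ (β - 1) = θ / C ^ β := by
      rw [hδ, ← Real.rpow_mul (by positivity), one_div_mul_cancel hβ1.ne', Real.rpow_one]
    have h2 : δ ^ β = δ ^ (β - 1) * δ := by
      rw [← Real.rpow_add_one hδ0.ne']; simp
    rw [Real.mul_rpow hC.le hδ0.le, h2, h1]
    field_simp
  refine ⟨δ, hδ0, fun a ha0 ha h0 => ?_⟩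
  have hak : ∀ k, a k ≤ δ * θ ^ k := by
    intro k
    induction k with
    | zero => simpa using h0
    | succ k ih =>
      calc a (k + 1) ≤ (C * B ^ k * a k) ^ β := ha k
        _ ≤ (C * B ^ k * (δ * θ ^ k)) ^ β :=
          Real.rpow_le_rpow (mul_nonneg (by positivity) (ha0 k)) (by gcongr) (by linarith)
        _ = (C * δ) ^ β * ((B * θ) ^ β) ^ k := by
          rw [← Real.rpow_natCast ((B * θ) ^ β), ← Real.rpow_mul (by positivity), mul_comm β,
            Real.rpow_mul (by positivity), Real.rpow_natCast,
            ← Real.mul_rpow (by positivity) (by positivity), mul_pow]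
          congr 1
          ring
        _ = δ * θ ^ (k + 1) := by rw [hCδ, hBθ]; ring
  refine squeeze_zero ha0 hak ?_
  simpa using (tendsto_pow_atTop_nhds_zero_of_lt_one hθ0.le hθ1).const_mul δ

/-- De Giorgi's lemma on levels, in a scale-invariant form: the constant in the hypothesis depends
on the levels `c' < c` through the ratio `c / (c - c')` only, so the starting level `M` can be
chosen so large that `A M` is below the smallness threshold. -/
theorem exists_eq_zero_of_level_recursion {A : ℝ → ℝ} {C γ β : ℝ} (hC : 0 < C) (hγ : 0 < γ)
    (hβ : 1 < β) (hA0 : ∀ c, 0 ≤ A c) (hanti : Antitone A) (hlim : Tendsto A atTop (𝓝 0))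
    (hrec : ∀ c' c, 1 ≤ c' → c' < c → A c ≤ (C * (c / (c - c')) ^ γ * A c') ^ β) :
    ∃ M, A M = 0 := by
  have h2 : (1 : ℝ) < 2 ^ γ := Real.one_lt_rpow (by norm_num) hγ
  obtain ⟨δ, hδ, H⟩ := exists_pos_tendsto_zero_of_recursion (C := C * 4 ^ γ) (B := 2 ^ γ) (β := β)
    (by positivity) h2 hβ
  obtain ⟨M, hMδ, hM1⟩ : ∃ M, A M < δ ∧ 1 ≤ M :=
    ((hlim.eventually_lt_const hδ).and (eventually_ge_atTop 1)).exists
  have hM0 : 0 < M := by linarith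
  set c : ℕ → ℝ := fun k => M * (2 - (1 / 2) ^ k) with hc
  have hhalf : ∀ k : ℕ, (0 : ℝ) < (1 / 2) ^ k ∧ ((1 : ℝ) / 2) ^ k ≤ 1 := fun k =>
    ⟨by positivity, pow_le_one₀ (by norm_num) (by norm_num)⟩
  have hc1 : ∀ k, 1 ≤ c k := fun k => by
    have := hhalf k
    simp only [hc]; nlinarith
  have hdiff : ∀ k, c (k + 1) - c k = M * (1 / 2) ^ k / 2 := fun k => by
    simp only [hc, pow_succ]; ring
  have hlim0 := H (fun k => A (c k)) (fun k => hA0 _) (fun k => by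
    have hd : 0 < c (k + 1) - c k := by
      rw [hdiff]; have := (hhalf k).1; positivity
    refine (hrec (c k) (c (k + 1)) (hc1 k) (by linarith)).trans ?_
    have hratio : c (k + 1) / (c (k + 1) - c k) ≤ 4 * 2 ^ k := by
      have h3 : (4 * 2 ^ k : ℝ) * (c (k + 1) - c k) = 2 * M := by
        rw [hdiff]
        have : (2 : ℝ) ^ k * (1 / 2) ^ k = 1 := by rw [← mul_pow]; norm_num
        linear_combination 2 * M * this
      rw [div_le_iff₀ hd, h3]
      have := (hhalf (k + 1)).1
      simp only [hc]; nlinarith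
    have h0 : 0 ≤ c (k + 1) / (c (k + 1) - c k) := div_nonneg (by linarith [hc1 (k + 1)]) hd.le
    have h4 : (c (k + 1) / (c (k + 1) - c k)) ^ γ ≤ 4 ^ γ * (2 ^ γ) ^ k := by
      refine (Real.rpow_le_rpow h0 hratio hγ.le).trans_eq ?_
      rw [Real.mul_rpow (by norm_num) (by positivity), ← Real.rpow_natCast, ← Real.rpow_natCast,
        ← Real.rpow_mul (by norm_num), ← Real.rpow_mul (by norm_num), mul_comm γ]
    refine Real.rpow_le_rpow (mul_nonneg (by positivity) (hA0 _)) ?_ (by linarith)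
    calc C * (c (k + 1) / (c (k + 1) - c k)) ^ γ * A (c k)
        ≤ C * (4 ^ γ * (2 ^ γ) ^ k) * A (c k) := by
          have := hA0 (c k)
          gcongr
      _ = C * 4 ^ γ * (2 ^ γ) ^ k * A (c k) := by ring)
    (by
      have : c 0 = M := by simp only [hc, pow_zero]; ring
      simpa only [this] using hMδ.le)
  refine ⟨2 * M, le_antisymm (ge_of_tendsto' hlim0 fun k => hanti ?_) (hA0 _)⟩
  have := (hhalf k).1
  simp only [hc]; nlinarith

end DeGiorgi

/-! ### The fractional Hardy inequality -/

section Hardy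

variable {E : Type*} [NormedAddCommGroup E] [NormedSpace ℝ E] [FiniteDimensional ℝ E]
  [MeasurableSpace E] [BorelSpace E]

theorem lintegral_min_norm_rpow_ne_top [Nontrivial E] (μ : Measure E) [μ.IsAddHaarMeasure]
    {d σ p : ℝ} (hd : d = Module.finrank ℝ E) (hσ : 0 < σ) (hσp : σ < p) :
    ∫⁻ h : E, ENNReal.ofReal (min 1 ‖h‖ ^ p / ‖h‖ ^ (d + σ)) ∂μ ≠ ⊤ := by
  have hdpos : 0 < Module.finrank ℝ E := Module.finrank_pos
  have key : Integrable (fun h : E => min 1 ‖h‖ ^ p / ‖h‖ ^ (d + σ)) μ := by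
    rw [integrable_fun_norm_addHaar μ (f := fun y : ℝ => min 1 y ^ p / y ^ (d + σ)),
      ← Set.Ioc_union_Ioi_eq_Ioi zero_le_one]
    have hpow : ∀ y : ℝ, 0 < y → y ^ (Module.finrank ℝ E - 1) = y ^ (d - 1) := fun y hy => by
      rw [← Real.rpow_natCast, Nat.cast_sub (by omega), hd]; simp
    refine IntegrableOn.union ?_ ?_
    · have h1 : IntegrableOn (fun y : ℝ => y ^ (p - 1 - σ)) (Set.Ioc 0 1) := by
        rw [← intervalIntegrable_iff_integrableOn_Ioc_of_le zero_le_one]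
        exact intervalIntegral.intervalIntegrable_rpow' (by linarith)
      refine h1.congr_fun (fun y hy => ?_) measurableSet_Ioc
      have hy0 : 0 < y := hy.1
      simp only [smul_eq_mul]
      rw [hpow y hy0, min_eq_right hy.2, mul_div_assoc', ← Real.rpow_add hy0,
        ← Real.rpow_sub hy0]
      congr 1
      ring
    · have h1 : IntegrableOn (fun y : ℝ => y ^ (-1 - σ)) (Set.Ioi 1) :=
        integrableOn_Ioi_rpow_of_lt (by linarith) one_pos
      refine h1.congr_fun (fun y hy => ?_) measurableSet_Ioi
      have hy1 : 1 < y := hy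
      have hy0 : 0 < y := by linarith
      simp only [smul_eq_mul]
      rw [hpow y hy0, min_eq_left hy1.le, Real.one_rpow, mul_one_div, ← Real.rpow_sub hy0]
      congr 1
      ring
  exact key.lintegral_lt_top.ne

theorem lintegral_min_div_rpow_eq (μ : Measure E) [μ.IsAddHaarMeasure]
    {d σ p : ℝ} (hd : d = Module.finrank ℝ E) {δ : ℝ} (hδ : 0 < δ) (x : E) :
    ∫⁻ y : E, ENNReal.ofReal (min 1 (‖x - y‖ / δ) ^ p / ‖x - y‖ ^ (d + σ)) ∂μ =
      ENNReal.ofReal (δ ^ (-σ)) *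
        ∫⁻ h : E, ENNReal.ofReal (min 1 ‖h‖ ^ p / ‖h‖ ^ (d + σ)) ∂μ := by
  rw [lintegral_sub_left_eq_self
    (fun y : E => ENNReal.ofReal (min 1 (‖y‖ / δ) ^ p / ‖y‖ ^ (d + σ))) x]
  have hmeas : Measurable fun h : E => ENNReal.ofReal (min 1 ‖h‖ ^ p / ‖h‖ ^ (d + σ)) := by
    fun_prop
  have h1 : ∀ y : E, ENNReal.ofReal (min 1 (‖y‖ / δ) ^ p / ‖y‖ ^ (d + σ)) =
      ENNReal.ofReal (δ ^ (-(d + σ))) *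
        ENNReal.ofReal (min 1 ‖δ⁻¹ • y‖ ^ p / ‖δ⁻¹ • y‖ ^ (d + σ)) := fun y => by
    rw [← ENNReal.ofReal_mul (by positivity)]
    congr 1
    rw [norm_smul, Real.norm_of_nonneg (by positivity), inv_mul_eq_div,
      Real.div_rpow (norm_nonneg y) hδ.le, Real.rpow_neg hδ.le]
    have : 0 < δ ^ (d + σ) := by positivity
    field_simp
  simp_rw [h1]
  rw [lintegral_const_mul' _ _ ENNReal.ofReal_ne_top,
    ← lintegral_map hmeas (measurable_const_smul δ⁻¹),
    Measure.map_addHaar_smul μ (inv_pos.2 hδ).ne', lintegral_smul_measure, smul_eq_mul,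
    ← mul_assoc, ← ENNReal.ofReal_mul (by positivity)]
  congr 2
  rw [inv_pow, inv_inv, abs_of_nonneg (by positivity), ← Real.rpow_natCast, ← hd,
    ← Real.rpow_add hδ]
  congr 1
  ring

theorem ofReal_rpow_le_lintegral_compl [Nontrivial E] (μ : Measure E) [μ.IsAddHaarMeasure] {d σ : ℝ}
    (hd : d = Module.finrank ℝ E) (hσ : 0 ≤ σ) {Ω : Set E} {ε R : ℝ} (hε : 0 < ε)
    (hR : 0 < R) (hcork : ExteriorCorkscrew Ω ε R) {x : E} (hx : x ∈ Ω) (hδ : 0 < infDist x Ωᶜ) :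
    ENNReal.ofReal (infDist x Ωᶜ ^ (-σ)) * ENNReal.ofReal (R ^ (-(d + σ)) * ε ^ d) *
      μ (ball 0 1) ≤ ∫⁻ y in Ωᶜ, ENNReal.ofReal (1 / ‖x - y‖ ^ (d + σ)) ∂μ := by
  set δ := infDist x Ωᶜ with hδdef
  have hd0 : 0 ≤ d := by rw [hd]; positivity
  obtain ⟨z, h1, h2⟩ := hcork x hx
  calc ENNReal.ofReal (δ ^ (-σ)) * ENNReal.ofReal (R ^ (-(d + σ)) * ε ^ d) * μ (ball 0 1)
      = ∫⁻ y in ball z (ε * δ), ENNReal.ofReal ((R * δ) ^ (-(d + σ))) ∂μ := by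
        rw [setLIntegral_const, Measure.addHaar_ball μ z (by positivity), ← mul_assoc,
          ← ENNReal.ofReal_mul (by positivity), ← ENNReal.ofReal_mul (by positivity),
          ← Real.rpow_natCast, ← hd]
        congr 2
        rw [Real.mul_rpow hR.le hδ.le, Real.mul_rpow hε.le hδ.le]
        have : δ ^ (-σ) = δ ^ (-(d + σ)) * δ ^ d := by
          rw [← Real.rpow_add hδ]; congr 1; ring
        rw [this]; ring
    _ ≤ ∫⁻ y in ball z (ε * δ), ENNReal.ofReal (1 / ‖x - y‖ ^ (d + σ)) ∂μ := by
        refine setLIntegral_mono' measurableSet_ball fun y hy => ENNReal.ofReal_le_ofReal ?_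
        have h3 : ‖x - y‖ ≤ R * δ := by
          have := h2 hy
          rw [mem_ball, dist_comm, dist_eq_norm] at this
          exact this.le
        have h4 : 0 < ‖x - y‖ := by
          rw [norm_pos_iff, sub_ne_zero]
          rintro rfl
          exact h1 hy hx
        rw [Real.rpow_neg (by positivity), one_div]
        gcongr
    _ ≤ _ := lintegral_mono_set h1

/-- Fractional Hardy inequality for functions vanishing outside a set with exterior corkscrews. The
weight `min 1 (|x - y| / dist(x, Ωᶜ))` integrates to a multiple of `dist(x, Ωᶜ)^(-σ)`, and so does
`|x - y|^(-d-σ)` over `y ∈ Ωᶜ`, where `u(x) = u(x) - u(y)`. -/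
theorem hardy_lintegral_ne_top [Nontrivial E] (μ : Measure E) [μ.IsAddHaarMeasure]
    {d σ p : ℝ} (hd : d = Module.finrank ℝ E) (hσ : 0 < σ) (hσp : σ < p) {Ω : Set E}
    (ho : IsOpen Ω) (hb : Bornology.IsBounded Ω) {ε R : ℝ} (hε : 0 < ε) (hR : 0 < R)
    (hcork : ExteriorCorkscrew Ω ε R) {u : E → ℝ} (hu : Measurable u) (hu0 : ∀ x, 0 ≤ u x)
    (huΩ : ∀ x ∉ Ω, u x = 0) (hE : gagliardo μ (d + σ) p u ≠ ⊤) :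
    ∫⁻ z : E × E, ENNReal.ofReal
      ((u z.1 * min 1 (‖z.1 - z.2‖ / infDist z.1 Ωᶜ)) ^ p / ‖z.1 - z.2‖ ^ (d + σ)) ∂(μ.prod μ)
      ≠ ⊤ := by
  have hp : 0 < p := hσ.trans hσp
  set C₁ := ∫⁻ h : E, ENNReal.ofReal (min 1 ‖h‖ ^ p / ‖h‖ ^ (d + σ)) ∂μ with hC₁
  have hC₁t : C₁ ≠ ⊤ := lintegral_min_norm_rpow_ne_top μ hd hσ hσp
  set C₂ := ENNReal.ofReal (R ^ (-(d + σ)) * ε ^ d) * μ (ball 0 1) with hC₂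
  have hC₂0 : C₂ ≠ 0 := mul_ne_zero (by simpa using not_le.2 (by positivity))
    (measure_ball_pos μ _ one_pos).ne'
  have hC₂t : C₂ ≠ ⊤ := ENNReal.mul_ne_top ENNReal.ofReal_ne_top measure_ball_lt_top.ne
  have hmeas : Measurable fun z : E × E => ENNReal.ofReal
      ((u z.1 * min 1 (‖z.1 - z.2‖ / infDist z.1 Ωᶜ)) ^ p / ‖z.1 - z.2‖ ^ (d + σ)) := by
    have h1 : Measurable fun z : E × E => infDist z.1 Ωᶜ :=
      ((continuous_infDist_pt Ωᶜ).comp continuous_fst).measurable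
    have h2 : Measurable fun z : E × E => ‖z.1 - z.2‖ :=
      (continuous_fst.sub continuous_snd).norm.measurable
    have h3 : Measurable fun z : E × E => u z.1 := hu.comp measurable_fst
    exact (((h3.mul (measurable_const.min (h2.div h1))).pow_const p).div
      (h2.pow_const _)).ennreal_ofReal
  refine ne_top_of_le_ne_top (ENNReal.mul_ne_top (ENNReal.div_ne_top hC₁t hC₂0) hE) ?_
  rw [lintegral_prod _ hmeas.aemeasurable, lintegral_gagliardo_eq μ hu,
    ← lintegral_const_mul' _ _ (ENNReal.div_ne_top hC₁t hC₂0)]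
  refine lintegral_mono fun x => ?_
  by_cases hx : x ∈ Ω
  swap
  · simp [huΩ x hx, Real.zero_rpow hp.ne']
  have hδ := infDist_compl_pos ho hb hx
  have hup : 0 ≤ u x ^ p := Real.rpow_nonneg (hu0 x) p
  calc ∫⁻ y, ENNReal.ofReal
        ((u x * min 1 (‖x - y‖ / infDist x Ωᶜ)) ^ p / ‖x - y‖ ^ (d + σ)) ∂μ
      = ENNReal.ofReal (u x ^ p) * (ENNReal.ofReal (infDist x Ωᶜ ^ (-σ)) * C₁) := by
        rw [hC₁, ← lintegral_min_div_rpow_eq μ hd hδ x,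
          ← lintegral_const_mul' _ _ ENNReal.ofReal_ne_top]
        refine lintegral_congr fun y => ?_
        rw [← ENNReal.ofReal_mul hup, Real.mul_rpow (hu0 x) (by positivity), mul_div_assoc]
    _ = C₁ / C₂ * (ENNReal.ofReal (u x ^ p) * (ENNReal.ofReal (infDist x Ωᶜ ^ (-σ)) * C₂)) := by
        rw [mul_comm (ENNReal.ofReal (infDist x Ωᶜ ^ (-σ))) C₂, mul_left_comm (C₁ / C₂),
          ← mul_assoc (C₁ / C₂), ENNReal.div_mul_cancel hC₂0 hC₂t,
          mul_comm (ENNReal.ofReal (infDist x Ωᶜ ^ (-σ))) C₁]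
    _ ≤ C₁ / C₂ * (ENNReal.ofReal (u x ^ p) *
          ∫⁻ y in Ωᶜ, ENNReal.ofReal (1 / ‖x - y‖ ^ (d + σ)) ∂μ) := by
        gcongr
        rw [hC₂, ← mul_assoc]
        exact ofReal_rpow_le_lintegral_compl μ hd hσ.le hε hR hcork hx hδ
    _ ≤ C₁ / C₂ * ∫⁻ y, ENNReal.ofReal (|u x - u y| ^ p / ‖x - y‖ ^ (d + σ)) ∂μ := by
        gcongr
        rw [← lintegral_const_mul' _ _ ENNReal.ofReal_ne_top]
        refine (setLIntegral_mono' ho.measurableSet.compl fun y hy => ?_).trans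
          (setLIntegral_le_lintegral Ωᶜ _)
        rw [← ENNReal.ofReal_mul hup, huΩ y hy, sub_zero, abs_of_nonneg (hu0 x), mul_one_div]

end Hardy

/-! ### The form of the fractional `p`-Laplacian -/

section Form

variable {E : Type*} [NormedAddCommGroup E]

/-- The integrand `|u(x)-u(y)|^(p-2) (u(x)-u(y)) (ψ(x)-ψ(y)) / |x-y|^κ` of the weak fractional
`p`-Laplacian. -/
noncomputable def formIntegrand (κ p : ℝ) (u ψ : E → ℝ) (z : E × E) : ℝ :=
  |u z.1 - u z.2| ^ (p - 2) * (u z.1 - u z.2) * (ψ z.1 - ψ z.2) / ‖z.1 - z.2‖ ^ κ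

theorem abs_rpow_sub_two_mul_mul_le {p : ℝ} (hp : 1 < p) {ε : ℝ} (hε : 0 < ε) {s t D : ℝ}
    (hD : |s| ≤ D) :
    |(|t| ^ (p - 2) * t * s)| ≤ ε * |t| ^ p + ε ^ (1 - p) * D ^ p := by
  have hD0 : 0 ≤ D := (abs_nonneg s).trans hD
  rcases eq_or_ne t 0 with rfl | ht
  · simp; positivity
  have ht0 : 0 < |t| := abs_pos.2 ht
  have h1 : |(|t| ^ (p - 2) * t * s)| = |t| ^ (p - 1) * |s| := by
    rw [abs_mul, abs_mul, abs_of_nonneg (by positivity : 0 ≤ |t| ^ (p - 2)),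
      ← Real.rpow_add_one ht0.ne']
    congr 2
    ring
  have h2 : |t| ^ p = |t| ^ (p - 1) * |t| := by
    rw [← Real.rpow_add_one ht0.ne']; congr 1; ring
  rw [h1]
  -- Either `D ≤ ε |t|`, and the first term dominates, or `|t| < D / ε`, and the second one does.
  rcases le_total D (ε * |t|) with h | h
  · calc |t| ^ (p - 1) * |s| ≤ |t| ^ (p - 1) * (ε * |t|) := by gcongr; exact hD.trans h
      _ = ε * |t| ^ p := by rw [h2]; ring
      _ ≤ _ := le_add_of_nonneg_right (by positivity)
  · have h3 : |t| ≤ D / ε := by rw [le_div_iff₀ hε]; linarith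
    have hDpos : 0 < D := lt_of_lt_of_le (by positivity) h
    calc |t| ^ (p - 1) * |s| ≤ (D / ε) ^ (p - 1) * D := by gcongr
      _ = ε ^ (1 - p) * D ^ p := by
          have h4 : D ^ p = D ^ (p - 1) * D := by
            rw [← Real.rpow_add_one hDpos.ne']; congr 1; ring
          have h5 : ε ^ (1 - p) = (ε ^ (p - 1))⁻¹ := by
            rw [← Real.rpow_neg hε.le]; congr 1; ring
          rw [Real.div_rpow hD0 hε.le, h4, h5]
          ring
      _ ≤ _ := le_add_of_nonneg_left (by positivity)

theorem norm_formIntegrand_le {κ p : ℝ} (hp : 1 < p) {ε : ℝ} (hε : 0 < ε) {u ψ : E → ℝ}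
    {z : E × E} {D : ℝ} (hD : |ψ z.1 - ψ z.2| ≤ D) :
    ‖formIntegrand κ p u ψ z‖ ≤ ε * (|u z.1 - u z.2| ^ p / ‖z.1 - z.2‖ ^ κ) +
      ε ^ (1 - p) * (D ^ p / ‖z.1 - z.2‖ ^ κ) := by
  have hK : 0 ≤ ‖z.1 - z.2‖ ^ κ := by positivity
  rw [formIntegrand, Real.norm_eq_abs, abs_div, abs_of_nonneg hK, ← mul_div_assoc,
    ← mul_div_assoc, ← add_div]
  exact div_le_div_of_nonneg_right (abs_rpow_sub_two_mul_mul_le hp hε hD) hK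

/-- The Gagliardo energy as the `p`-th power of an `L^p` norm on `E × E`. -/
theorem gagliardo_eq_eLpNorm_rpow {E : Type*} [NormedAddCommGroup E] [MeasurableSpace E]
    (μ : Measure E) {κ p : ℝ} (hp : 0 < p) (w : E → ℝ) :
    gagliardo μ κ p w = eLpNorm (fun z : E × E => (w z.1 - w z.2) / ‖z.1 - z.2‖ ^ (κ / p))
      (ENNReal.ofReal p) (μ.prod μ) ^ p := by
  rw [eLpNorm_eq_lintegral_rpow_enorm_toReal (by simpa using hp) ENNReal.ofReal_ne_top,
    ENNReal.toReal_ofReal hp.le, ← ENNReal.rpow_mul, one_div_mul_cancel hp.ne', ENNReal.rpow_one,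
    gagliardo]
  refine lintegral_congr fun z => ?_
  rw [← ofReal_norm, ENNReal.ofReal_rpow_of_nonneg (norm_nonneg _) hp.le,
    Real.norm_eq_abs, abs_div, abs_of_nonneg (by positivity : 0 ≤ ‖z.1 - z.2‖ ^ (κ / p)),
    Real.div_rpow (abs_nonneg _) (by positivity), ← Real.rpow_mul (norm_nonneg _),
    div_mul_cancel₀ _ hp.ne']

variable [NormedSpace ℝ E] [FiniteDimensional ℝ E] [MeasurableSpace E] [BorelSpace E]

theorem measurable_formIntegrand {κ p : ℝ} {u ψ : E → ℝ} (hu : Measurable u) (hψ : Measurable ψ) :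
    Measurable (formIntegrand κ p u ψ) := by
  have h1 : Measurable fun z : E × E => u z.1 - u z.2 :=
    (hu.comp measurable_fst).sub (hu.comp measurable_snd)
  have h2 : Measurable fun z : E × E => ψ z.1 - ψ z.2 :=
    (hψ.comp measurable_fst).sub (hψ.comp measurable_snd)
  have h3 : Measurable fun z : E × E => ‖z.1 - z.2‖ :=
    (continuous_fst.sub continuous_snd).norm.measurable
  have h4 : Measurable fun z : E × E => |u z.1 - u z.2| := by
    simpa only [Real.norm_eq_abs] using h1.norm
  exact (((h4.pow_const _).mul h1).mul h2).div (h3.pow_const κ)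

variable (μ : Measure E)

theorem integrable_of_gagliardo {κ p : ℝ} {w : E → ℝ} (hw : Measurable w)
    (hE : gagliardo μ κ p w ≠ ⊤) :
    Integrable (fun z : E × E => |w z.1 - w z.2| ^ p / ‖z.1 - z.2‖ ^ κ) (μ.prod μ) := by
  refine ⟨(measurable_gagliardo_integrand hw).aestronglyMeasurable, ?_⟩
  rw [hasFiniteIntegral_iff_ofReal (Eventually.of_forall fun z => by positivity)]
  exact hE.lt_top

theorem integral_eq_toReal_gagliardo {κ p : ℝ} {w : E → ℝ} (hw : Measurable w) :
    ∫ z : E × E, |w z.1 - w z.2| ^ p / ‖z.1 - z.2‖ ^ κ ∂(μ.prod μ) =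
      (gagliardo μ κ p w).toReal :=
  integral_eq_lintegral_of_nonneg_ae (Eventually.of_forall fun z => by positivity)
    (measurable_gagliardo_integrand hw).aestronglyMeasurable

theorem integrable_formIntegrand {κ p : ℝ} (hp : 1 < p) {u ψ : E → ℝ} (hu : Measurable u)
    (hψ : Measurable ψ) (huE : gagliardo μ κ p u ≠ ⊤) (hψE : gagliardo μ κ p ψ ≠ ⊤) :
    Integrable (formIntegrand κ p u ψ) (μ.prod μ) :=
  (((integrable_of_gagliardo μ hu huE).const_mul 1).add
    ((integrable_of_gagliardo μ hψ hψE).const_mul (1 ^ (1 - p)))).mono'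
    (measurable_formIntegrand hu hψ).aestronglyMeasurable
    (Eventually.of_forall fun _ => norm_formIntegrand_le hp one_pos le_rfl)

theorem integral_norm_formIntegrand_le {κ p : ℝ} (hp : 1 < p) {u ψ : E → ℝ} (hu : Measurable u)
    (hψ : Measurable ψ) (huE : gagliardo μ κ p u ≠ ⊤) (hψE : gagliardo μ κ p ψ ≠ ⊤) {ε : ℝ}
    (hε : 0 < ε) :
    ∫ z, ‖formIntegrand κ p u ψ z‖ ∂(μ.prod μ) ≤
      ε * (gagliardo μ κ p u).toReal + ε ^ (1 - p) * (gagliardo μ κ p ψ).toReal := by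
  have h1 := (integrable_of_gagliardo μ hu huE).const_mul ε
  have h2 := (integrable_of_gagliardo μ hψ hψE).const_mul (ε ^ (1 - p))
  rw [← integral_eq_toReal_gagliardo μ hu, ← integral_eq_toReal_gagliardo μ hψ,
    ← integral_const_mul, ← integral_const_mul, ← integral_add h1 h2]
  exact integral_mono (integrable_formIntegrand μ hp hu hψ huE hψE).norm (h1.add h2)
    fun _ => norm_formIntegrand_le hp hε le_rfl

variable [μ.IsAddHaarMeasure]

theorem gagliardo_comp_add_right {κ p : ℝ} (w : E → ℝ) (t : E) :
    gagliardo μ κ p (fun x => w (x + t)) = gagliardo μ κ p w := by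
  unfold gagliardo
  rw [← lintegral_add_right_eq_self
    (fun z : E × E => ENNReal.ofReal (|w z.1 - w z.2| ^ p / ‖z.1 - z.2‖ ^ κ)) (t, t)]
  simp

/-- Translations act continuously on functions of finite Gagliardo energy: this is continuity of
translations in `L^p(E × E)`, applied to the diagonal translations `z ↦ z + (t, t)`. -/
theorem tendsto_gagliardo_translate_sub {κ p : ℝ} (hp : 1 < p) {w : E → ℝ} (hw : Measurable w)
    (hE : gagliardo μ κ p w ≠ ⊤) :
    Tendsto (fun t => gagliardo μ κ p (fun x => w (x + t) - w x)) (𝓝 0) (𝓝 0) := by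
  have hp0 : 0 < p := by linarith
  have : Fact (1 ≤ ENNReal.ofReal p) := ⟨by simpa using hp.le⟩
  set F : E × E → ℝ := fun z => (w z.1 - w z.2) / ‖z.1 - z.2‖ ^ (κ / p) with hF
  have hFm : Measurable F := by
    have h1 : Measurable fun z : E × E => w z.1 - w z.2 :=
      (hw.comp measurable_fst).sub (hw.comp measurable_snd)
    have h3 : Measurable fun z : E × E => ‖z.1 - z.2‖ :=
      (continuous_fst.sub continuous_snd).norm.measurable
    exact h1.div (h3.pow_const _)
  have hFL : MemLp F (ENNReal.ofReal p) (μ.prod μ) := by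
    refine ⟨hFm.aestronglyMeasurable, ?_⟩
    rw [gagliardo_eq_eLpNorm_rpow μ hp0] at hE
    exact lt_top_iff_ne_top.2 fun h => hE (by rw [h, ENNReal.top_rpow_of_pos hp0])
  set g : E → C(E × E, E × E) := fun t => ⟨fun z => z + (t, t), by fun_prop⟩ with hg
  have hgm : ∀ t, MeasurePreserving (g t) (μ.prod μ) (μ.prod μ) := fun t =>
    measurePreserving_add_right (μ.prod μ) (t, t)
  have hgc : Continuous g :=
    (ContinuousMap.curry ⟨fun q : E × (E × E) => q.2 + (q.1, q.1), by fun_prop⟩).continuous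
  have hlim := (tendsto_const_nhds (x := hFL.toLp F) (f := 𝓝 (0 : E))).compMeasurePreservingLp
    (hgc.tendsto 0) hgm (hgm 0) ENNReal.ofReal_ne_top
  have hg0 : Lp.compMeasurePreserving (g 0) (hgm 0) (hFL.toLp F) = hFL.toLp F := by
    rw [Lp.toLp_compMeasurePreserving hFL (hgm 0)]
    congr 1
    ext z
    simp [hg, ← Prod.zero_eq_mk]
  rw [hg0, Lp.tendsto_Lp_iff_tendsto_eLpNorm'] at hlim
  have hpow := (ENNReal.continuous_rpow_const (y := p)).tendsto 0 |>.comp hlim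
  rw [ENNReal.zero_rpow_of_pos hp0] at hpow
  refine hpow.congr fun t => ?_
  rw [gagliardo_eq_eLpNorm_rpow μ hp0, Function.comp_apply]
  congr 1
  refine eLpNorm_congr_ae ?_
  have h1 := Lp.coeFn_compMeasurePreserving (hFL.toLp F) (hgm t)
  have h2 := (hgm t).quasiMeasurePreserving.ae_eq_comp hFL.coeFn_toLp
  filter_upwards [h1, h2, hFL.coeFn_toLp] with z hz1 hz2 hz3
  rw [Pi.sub_apply, hz1, hz2, hz3]
  simp only [hF, hg, Function.comp_apply, ContinuousMap.coe_mk, Prod.fst_add, Prod.snd_add,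
    add_sub_add_right_eq_sub]
  ring

end Form

/-! ### Mollification of test functions -/

section Mollify

variable {E : Type*} [NormedAddCommGroup E] [NormedSpace ℝ E] [FiniteDimensional ℝ E]
  [MeasurableSpace E] [BorelSpace E] (μ : Measure E) [μ.IsAddHaarMeasure]

theorem formIntegrand_sub {E : Type*} [NormedAddCommGroup E] {κ p : ℝ} (u ψ₁ ψ₂ : E → ℝ)
    (z : E × E) :
    formIntegrand κ p u (fun x => ψ₁ x - ψ₂ x) z =
      formIntegrand κ p u ψ₁ z - formIntegrand κ p u ψ₂ z := by
  simp only [formIntegrand]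
  ring

/-- The form tested against translates of `φ` depends continuously on the translation at `0`. -/
theorem exists_ball_dist_form_translate_le {κ p : ℝ} (hp : 1 < p) {u φ : E → ℝ}
    (hu : Measurable u) (hφ : Measurable φ) (huE : gagliardo μ κ p u ≠ ⊤)
    (hφE : gagliardo μ κ p φ ≠ ⊤) {η : ℝ} (hη : 0 < η) :
    ∃ δ > 0, ∀ t ∈ ball (0 : E) δ,
      dist (∫ z, formIntegrand κ p u (fun x => φ (x + t)) z ∂(μ.prod μ))
        (∫ z, formIntegrand κ p u φ z ∂(μ.prod μ)) ≤ η := by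
  set G := (gagliardo μ κ p u).toReal with hG
  have hG0 : 0 ≤ G := ENNReal.toReal_nonneg
  set ε := η / (2 * (G + 1)) with hε
  have hε0 : 0 < ε := by positivity
  have hεG : ε * G ≤ η / 2 := by
    rw [hε, div_mul_eq_mul_div, div_le_div_iff₀ (by positivity) (by norm_num)]
    nlinarith
  have hpos : 0 < ENNReal.ofReal (η / 2 / ε ^ (1 - p)) := by
    rw [ENNReal.ofReal_pos]; positivity
  obtain ⟨δ, hδ, H⟩ := Metric.eventually_nhds_iff_ball.1
    ((tendsto_gagliardo_translate_sub μ hp hφ hφE).eventually_lt_const hpos)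
  refine ⟨δ, hδ, fun t ht => ?_⟩
  have hφt : Measurable fun x => φ (x + t) := hφ.comp (measurable_add_const t)
  have hlt := H t ht
  have hdE : gagliardo μ κ p (fun x => φ (x + t) - φ x) ≠ ⊤ := (hlt.trans_le le_top).ne
  rw [dist_eq_norm, ← integral_sub
    (integrable_formIntegrand μ hp hu hφt huE (by rwa [gagliardo_comp_add_right]))
    (integrable_formIntegrand μ hp hu hφ huE hφE)]
  simp_rw [← formIntegrand_sub]
  refine (norm_integral_le_integral_norm _).trans
    ((integral_norm_formIntegrand_le μ (ψ := fun x => φ (x + t) - φ x) hp hu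
      (hφt.sub hφ) huE hdE hε0).trans ?_)
  have h1 : (gagliardo μ κ p (fun x => φ (x + t) - φ x)).toReal ≤ η / 2 / ε ^ (1 - p) :=
    ENNReal.toReal_le_of_le_ofReal (by positivity) hlt.le
  have h2 : ε ^ (1 - p) * (gagliardo μ κ p (fun x => φ (x + t) - φ x)).toReal ≤ η / 2 := by
    rw [le_div_iff₀ (by positivity)] at h1
    linarith
  linarith

theorem integrable_normed_mul_translate (ρ : ContDiffBump (0 : E)) {φ : E → ℝ}
    (hφ : Measurable φ) {M : ℝ} (hM : ∀ x, |φ x| ≤ M) (x : E) :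
    Integrable (fun t => ρ.normed μ t * φ (x - t)) μ :=
  ρ.integrable_normed.mul_bdd (c := M)
    (hφ.comp (measurable_const_sub x)).aestronglyMeasurable
    (Eventually.of_forall fun t => by simpa using hM (x - t))

theorem abs_convolution_le (ρ : ContDiffBump (0 : E)) {φ : E → ℝ} (hφ : Measurable φ) {M : ℝ}
    (hM : ∀ x, |φ x| ≤ M) (x : E) :
    |(ρ.normed μ ⋆[ContinuousLinearMap.lsmul ℝ ℝ, μ] φ) x| ≤ M := by
  simp only [convolution_def, ContinuousLinearMap.lsmul_apply, smul_eq_mul]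
  calc |∫ t, ρ.normed μ t * φ (x - t) ∂μ| ≤ ∫ t, |ρ.normed μ t * φ (x - t)| ∂μ :=
        abs_integral_le_integral_abs
    _ ≤ ∫ t, ρ.normed μ t * M ∂μ := by
        refine integral_mono (integrable_normed_mul_translate μ ρ hφ hM x).abs
          (ρ.integrable_normed.mul_const M) fun t => ?_
        simp only [abs_mul, abs_of_nonneg (ρ.nonneg_normed t)]
        exact mul_le_mul_of_nonneg_left (hM _) (ρ.nonneg_normed t)
    _ = M := by rw [integral_mul_const, ρ.integral_normed, one_mul]

/-- Testing against a mollification is the same as mollifying, in the translation parameter, the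
form tested against translates. -/
theorem integral_formIntegrand_convolution {κ p : ℝ} (hp : 1 < p) {u φ : E → ℝ}
    (hu : Measurable u) (hφ : Measurable φ) (huE : gagliardo μ κ p u ≠ ⊤)
    (hφE : gagliardo μ κ p φ ≠ ⊤) {M : ℝ} (hM : ∀ x, |φ x| ≤ M) (ρ : ContDiffBump (0 : E)) :
    ∫ z, formIntegrand κ p u (ρ.normed μ ⋆[ContinuousLinearMap.lsmul ℝ ℝ, μ] φ) z ∂(μ.prod μ) =
      (ρ.normed μ ⋆[ContinuousLinearMap.lsmul ℝ ℝ, μ]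
        fun t => ∫ z, formIntegrand κ p u (fun x => φ (x + t)) z ∂(μ.prod μ)) 0 := by
  set H : E × E → E → ℝ := fun z t =>
    ρ.normed μ t * formIntegrand κ p u (fun x => φ (x - t)) z with hH
  have hφt : ∀ t, Measurable fun x => φ (x - t) := fun t => hφ.comp (measurable_sub_const t)
  have hφtE : ∀ t, gagliardo μ κ p (fun x => φ (x - t)) = gagliardo μ κ p φ := fun t => by
    simpa [sub_eq_add_neg] using gagliardo_comp_add_right μ (κ := κ) (p := p) φ (-t)
  have hHm : Measurable (Function.uncurry H) := by
    have h1 : Measurable fun q : (E × E) × E => u q.1.1 - u q.1.2 := by fun_prop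
    have h2 : Measurable fun q : (E × E) × E => φ (q.1.1 - q.2) - φ (q.1.2 - q.2) := by
      have ha : Measurable fun q : (E × E) × E => q.1.1 - q.2 :=
        (continuous_fst.fst.sub continuous_snd).measurable
      have hb : Measurable fun q : (E × E) × E => q.1.2 - q.2 :=
        (continuous_fst.snd.sub continuous_snd).measurable
      exact (hφ.comp ha).sub (hφ.comp hb)
    have h3 : Measurable fun q : (E × E) × E => ‖q.1.1 - q.1.2‖ :=
      (continuous_fst.fst.sub continuous_fst.snd).norm.measurable
    have h4 : Measurable fun q : (E × E) × E => |u q.1.1 - u q.1.2| := by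
      simpa only [Real.norm_eq_abs] using h1.norm
    have h5 : Measurable fun q : (E × E) × E => ρ.normed μ q.2 :=
      ρ.continuous_normed.measurable.comp measurable_snd
    exact h5.mul ((((h4.pow_const _).mul h1).mul h2).div (h3.pow_const κ))
  have hHint : Integrable (Function.uncurry H) ((μ.prod μ).prod μ) := by
    rw [integrable_prod_iff' hHm.aestronglyMeasurable]
    refine ⟨Eventually.of_forall fun t => (integrable_formIntegrand μ hp hu (hφt t) huE
      (by rwa [hφtE])).const_mul (ρ.normed μ t), ?_⟩
    refine (ρ.integrable_normed.mul_const
      (1 * (gagliardo μ κ p u).toReal + 1 ^ (1 - p) * (gagliardo μ κ p φ).toReal)).mono'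
      (hHm.comp measurable_swap).norm.aestronglyMeasurable.integral_prod_right'
      (Eventually.of_forall fun t => ?_)
    rw [Real.norm_of_nonneg (integral_nonneg fun _ => norm_nonneg _)]
    simp only [Function.uncurry, hH, norm_mul, Real.norm_of_nonneg (ρ.nonneg_normed t)]
    rw [integral_const_mul]
    refine mul_le_mul_of_nonneg_left ?_ (ρ.nonneg_normed t)
    rw [← hφtE t]
    exact integral_norm_formIntegrand_le μ hp hu (hφt t) huE (by rwa [hφtE]) one_pos
  calc ∫ z, formIntegrand κ p u (ρ.normed μ ⋆[ContinuousLinearMap.lsmul ℝ ℝ, μ] φ) z ∂(μ.prod μ)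
      = ∫ z, ∫ t, H z t ∂μ ∂(μ.prod μ) := by
        refine integral_congr_ae (Eventually.of_forall fun z => ?_)
        simp only [hH, formIntegrand, convolution_def, ContinuousLinearMap.lsmul_apply,
          smul_eq_mul]
        rw [← integral_sub (integrable_normed_mul_translate μ ρ hφ hM _)
          (integrable_normed_mul_translate μ ρ hφ hM _), ← integral_const_mul, ← integral_div]
        refine integral_congr_ae (Eventually.of_forall fun t => ?_)
        simp only
        ring
    _ = ∫ t, ∫ z, H z t ∂(μ.prod μ) ∂μ := integral_integral_swap hHint
    _ = _ := by
        simp only [convolution_def, ContinuousLinearMap.lsmul_apply, smul_eq_mul, hH,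
          integral_const_mul, sub_eq_add_neg, zero_add]

theorem tendsto_integral_formIntegrand_convolution {κ p : ℝ} (hp : 1 < p) {u φ : E → ℝ}
    (hu : Measurable u) (hφ : Measurable φ) (huE : gagliardo μ κ p u ≠ ⊤)
    (hφE : gagliardo μ κ p φ ≠ ⊤) {M : ℝ} (hM : ∀ x, |φ x| ≤ M)
    {ρ : ℕ → ContDiffBump (0 : E)} (hρ : Tendsto (fun k => (ρ k).rOut) atTop (𝓝 0)) :
    Tendsto (fun k => ∫ z, formIntegrand κ p u
      ((ρ k).normed μ ⋆[ContinuousLinearMap.lsmul ℝ ℝ, μ] φ) z ∂(μ.prod μ)) atTop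
      (𝓝 (∫ z, formIntegrand κ p u φ z ∂(μ.prod μ))) := by
  have hTm : AEStronglyMeasurable
      (fun t => ∫ z, formIntegrand κ p u (fun x => φ (x + t)) z ∂(μ.prod μ)) μ := by
    have hm : Measurable fun q : E × (E × E) => formIntegrand κ p u (fun x => φ (x + q.1)) q.2 := by
      have h1 : Measurable fun q : E × (E × E) => u q.2.1 - u q.2.2 := by fun_prop
      have h2 : Measurable fun q : E × (E × E) => φ (q.2.1 + q.1) - φ (q.2.2 + q.1) := by
        have ha : Measurable fun q : E × (E × E) => q.2.1 + q.1 :=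
          (continuous_snd.fst.add continuous_fst).measurable
        have hb : Measurable fun q : E × (E × E) => q.2.2 + q.1 :=
          (continuous_snd.snd.add continuous_fst).measurable
        exact (hφ.comp ha).sub (hφ.comp hb)
      have h3 : Measurable fun q : E × (E × E) => ‖q.2.1 - q.2.2‖ :=
        (continuous_snd.fst.sub continuous_snd.snd).norm.measurable
      have h4 : Measurable fun q : E × (E × E) => |u q.2.1 - u q.2.2| := by
        simpa only [Real.norm_eq_abs] using h1.norm
      exact (((h4.pow_const _).mul h1).mul h2).div (h3.pow_const κ)
    exact hm.aestronglyMeasurable.integral_prod_right'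
  rw [Metric.tendsto_nhds]
  intro η hη
  obtain ⟨δ, hδ, H⟩ := exists_ball_dist_form_translate_le μ hp hu hφ huE hφE (half_pos hη)
  filter_upwards [hρ.eventually_lt_const hδ] with k hk
  rw [integral_formIntegrand_convolution μ hp hu hφ huE hφE hM]
  have h0 := (ρ k).dist_normed_convolution_le (μ := μ) (x₀ := (0 : E)) hTm (ε := η / 2) (by
    intro t ht
    simpa using H t (ball_subset_ball hk.le ht))
  simp only [add_zero] at h0
  linarith

/-- If the weak equation with right-hand side `f` holds for test functions in `C_c^∞(Ω)`, then it
holds for bounded functions of finite energy with compact support in `Ω`. -/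
theorem weak_eq_of_isCompact {κ p : ℝ} (hp : 1 < p) {Ω : Set E} (ho : IsOpen Ω) {u f : E → ℝ}
    (hu : Measurable u) (huE : gagliardo μ κ p u ≠ ⊤)
    (hweak : ∀ ψ : E → ℝ, ContDiff ℝ ∞ ψ → HasCompactSupport ψ → tsupport ψ ⊆ Ω →
      IntegrableOn (fun x => f x * ψ x) Ω μ ∧
        ∫ z, formIntegrand κ p u ψ z ∂(μ.prod μ) = ∫ x in Ω, f x * ψ x ∂μ)
    {φ : E → ℝ} (hφ : Measurable φ) (hφE : gagliardo μ κ p φ ≠ ⊤) {M : ℝ} (hM : ∀ x, |φ x| ≤ M)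
    {K : Set E} (hK : IsCompact K) (hKΩ : K ⊆ Ω) (hφK : ∀ x ∉ K, φ x = 0) :
    ∫ z, formIntegrand κ p u φ z ∂(μ.prod μ) = ∫ x in Ω, f x * φ x ∂μ := by
  have hM0 : 0 ≤ M := (abs_nonneg _).trans (hM 0)
  obtain ⟨δ, hδ, hδΩ⟩ := hK.exists_cthickening_subset_open ho hKΩ
  set K' := cthickening δ K with hK'def
  have hK' : IsCompact K' := hK.cthickening
  obtain ⟨η, hη, hηΩ⟩ := hK'.exists_cthickening_subset_open ho hδΩ
  -- A cutoff function equal to `1` on `K'` shows that `f` is integrable on `K'`.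
  have hfK' : IntegrableOn f K' μ := by
    obtain ⟨χ, hχ, -, hχs, hχ1⟩ := exists_contMDiff_support_eq_eq_one_iff (n := ⊤)
      (modelWithCornersSelf ℝ E) (isOpen_thickening (δ := η) (E := K')) hK'.isClosed
      (self_subset_thickening hη K')
    have hts : tsupport χ ⊆ cthickening η K' := by
      rw [tsupport, hχs]
      exact closure_thickening_subset_cthickening η K'
    have h1 := (hweak χ hχ.contDiff (hK'.cthickening.of_isClosed_subset (isClosed_tsupport χ) hts)
      (hts.trans hηΩ)).1
    refine (h1.mono_set hδΩ).congr_fun (fun x hx => ?_) hK'.measurableSet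
    simp [(hχ1 x).1 hx]
  set ρ : ℕ → ContDiffBump (0 : E) := fun k =>
    ⟨1 / 2 / ((k : ℝ) + 1), 1 / ((k : ℝ) + 1), by positivity, by gcongr; norm_num⟩ with hρdef
  have hρ : Tendsto (fun k => (ρ k).rOut) atTop (𝓝 0) := tendsto_one_div_add_atTop_nhds_zero_nat
  have hφint : Integrable φ μ := by
    refine (integrable_indicator_iff hK.measurableSet |>.2
      (integrableOn_const hK.measure_lt_top.ne (C := M))).mono' hφ.aestronglyMeasurable
      (Eventually.of_forall fun x => ?_)
    by_cases hx : x ∈ K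
    · simpa [hx] using hM x
    · simp [hx, hφK x hx]
  set φk : ℕ → E → ℝ := fun k => (ρ k).normed μ ⋆[ContinuousLinearMap.lsmul ℝ ℝ, μ] φ with hφk
  have hL := tendsto_integral_formIntegrand_convolution μ hp hu hφ huE hφE hM hρ
  have hsupp : ∀ᶠ k in atTop, ∀ x ∉ K', φk k x = 0 := by
    filter_upwards [hρ.eventually_lt_const hδ] with k hk x hx
    by_contra hne
    obtain ⟨y, hy, z, hz, rfl⟩ := support_convolution_subset_swap _
      (show x ∈ Function.support (φk k) from hne)
    have hyK : y ∈ K := by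
      by_contra h
      exact hy (hφK y h)
    rw [(ρ k).support_normed_eq] at hz
    refine hx (mem_cthickening_of_dist_le _ y δ K hyK ?_)
    rw [mem_ball_zero_iff] at hz
    simp only [dist_self_add_left]
    exact (hz.trans hk).le
  have hts : ∀ᶠ k in atTop, tsupport (φk k) ⊆ K' := by
    filter_upwards [hsupp] with k hk
    refine closure_minimal (fun x hx => ?_) hK'.isClosed
    by_contra h
    exact hx (hk x h)
  have htest : ∀ᶠ k in atTop, IntegrableOn (fun x => f x * φk k x) Ω μ ∧
        ∫ z, formIntegrand κ p u (φk k) z ∂(μ.prod μ) = ∫ x in Ω, f x * φk k x ∂μ := by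
    filter_upwards [hts] with k hk
    refine hweak _ ?_ (hK'.of_isClosed_subset (isClosed_tsupport _) hk) (hk.trans hδΩ)
    exact (ρ k).hasCompactSupport_normed.contDiff_convolution_left _ (n := ⊤)
      (ρ k).contDiff_normed hφint.locallyIntegrable
  have hR : Tendsto (fun k => ∫ x in Ω, f x * φk k x ∂μ) atTop (𝓝 (∫ x in Ω, f x * φ x ∂μ)) := by
    refine tendsto_integral_filter_of_dominated_convergence
      (fun x => K'.indicator (fun x => ‖f x‖ * M) x) ?_ ?_ ?_ ?_
    · filter_upwards [htest] with k hk using hk.1.aestronglyMeasurable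
    · filter_upwards [hsupp] with k hk
      refine Eventually.of_forall fun x => ?_
      by_cases hx : x ∈ K'
      · rw [Set.indicator_of_mem hx, norm_mul]
        gcongr
        exact abs_convolution_le μ (ρ k) hφ hM x
      · simp [hk x hx, hx]
    · exact ((integrable_indicator_iff hK'.measurableSet).2 (hfK'.norm.mul_const M)).restrict
    · have := ContDiffBump.ae_convolution_tendsto_right_of_locallyIntegrable (μ := μ) (φ := ρ)
        (K := 2) hρ (Eventually.of_forall fun k => by
          simp only [hρdef]; apply le_of_eq; ring) hφint.locallyIntegrable
      filter_upwards [ae_restrict_of_ae this] with x hx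
      exact hx.const_mul (f x)
  refine tendsto_nhds_unique hL (hR.congr' ?_)
  filter_upwards [htest] with k hk using hk.2.symm

end Mollify

/-! ### The energy inequality -/

section Energy

/-- The ramp that vanishes on `(-∞, 1]` and equals `1` on `[2, ∞)`. -/
def ramp (τ : ℝ) : ℝ := max 0 (min 1 (τ - 1))

theorem ramp_nonneg (τ : ℝ) : 0 ≤ ramp τ := le_max_left _ _

theorem ramp_le_one (τ : ℝ) : ramp τ ≤ 1 := max_le zero_le_one (min_le_left _ _)

theorem ramp_of_le_one {τ : ℝ} (h : τ ≤ 1) : ramp τ = 0 :=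
  max_eq_left ((min_le_right _ _).trans (by linarith))

theorem ramp_of_two_le {τ : ℝ} (h : 2 ≤ τ) : ramp τ = 1 := by
  rw [ramp, min_eq_left (by linarith), max_eq_right zero_le_one]

theorem continuous_ramp : Continuous ramp := by unfold ramp; fun_prop

theorem abs_ramp_sub_le (τ τ' : ℝ) : |ramp τ - ramp τ'| ≤ |τ - τ'| := by
  have h1 := abs_max_sub_max_le_abs (min 1 (τ - 1)) (min 1 (τ' - 1)) 0
  have h2 := abs_min_sub_min_le_max 1 (τ - 1) 1 (τ' - 1)
  simp only [sub_self, abs_zero, sub_sub_sub_cancel_right] at h2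
  rw [max_comm _ 0, max_comm _ 0] at h1
  exact h1.trans (h2.trans (max_le (abs_nonneg _) le_rfl))

/-- A scale-invariant modulus of continuity: `τ ↦ ramp (k τ)` satisfies the same bound, uniformly
in `k`. -/
theorem abs_ramp_sub_le_mul_min {τ τ' : ℝ} (hτ : 0 < τ) :
    |ramp τ - ramp τ'| ≤ 2 * min 1 (|τ - τ'| / τ) := by
  have h1 : |ramp τ - ramp τ'| ≤ 1 := by
    rw [abs_le]
    constructor <;> linarith [ramp_nonneg τ, ramp_nonneg τ', ramp_le_one τ, ramp_le_one τ']
  suffices h : |ramp τ - ramp τ'| ≤ 2 * (|τ - τ'| / τ) by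
    rcases min_cases 1 (|τ - τ'| / τ) with ⟨h', -⟩ | ⟨h', -⟩ <;> rw [h'] <;> linarith
  rw [mul_div_assoc', le_div_iff₀ hτ]
  rcases le_total τ 2 with h2 | h2
  · have := abs_ramp_sub_le τ τ'
    nlinarith [abs_nonneg (ramp τ - ramp τ')]
  rw [ramp_of_two_le h2] at h1 ⊢
  rcases le_total 2 τ' with h3 | h3
  · rw [ramp_of_two_le h3]; simp
  -- Here `τ' ≤ 2 ≤ τ`, and the bound for the pair `(2, τ')` improves as `2` is increased to `τ`.
  have h4 := abs_ramp_sub_le 2 τ'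
  rw [ramp_of_two_le le_rfl, abs_of_nonneg (by linarith : 0 ≤ 2 - τ')] at h4
  rw [abs_of_nonneg (by linarith : 0 ≤ τ - τ')]
  nlinarith

theorem abs_posPart_sub_le (a b c : ℝ) : |max (a - c) 0 - max (b - c) 0| ≤ |a - b| := by
  simpa using abs_max_sub_max_le_abs (a - c) (b - c) 0

/-- Testing with a truncation recovers its energy: `s = (a - c)_+ - (b - c)_+` has the sign of
`a - b` and `|s| ≤ |a - b|`. -/
theorem abs_posPart_sub_rpow_le {p : ℝ} (hp : 1 < p) (a b c : ℝ) :
    |max (a - c) 0 - max (b - c) 0| ^ p ≤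
      |a - b| ^ (p - 2) * (a - b) * (max (a - c) 0 - max (b - c) 0) := by
  have hle := abs_posPart_sub_le a b c
  set s := max (a - c) 0 - max (b - c) 0 with hs
  rcases eq_or_ne a b with rfl | hab
  · simp [hs, Real.zero_rpow (by linarith : p ≠ 0)]
  have ht0 : 0 < |a - b| := abs_pos.2 (sub_ne_zero.2 hab)
  have hsign : (a - b) * s = |a - b| * |s| := by
    rcases le_total a b with h | h
    · have : s ≤ 0 := sub_nonpos.2 (max_le_max_right 0 (by linarith))
      rw [abs_of_nonpos this, abs_of_nonpos (by linarith)]; ring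
    · have : 0 ≤ s := sub_nonneg.2 (max_le_max_right 0 (by linarith))
      rw [abs_of_nonneg this, abs_of_nonneg (by linarith)]
  calc |s| ^ p = |s| ^ (p - 1) * |s| := by
        rcases eq_or_ne s 0 with h | h
        · simp [h, Real.zero_rpow (by linarith : p ≠ 0)]
        · rw [← Real.rpow_add_one (abs_ne_zero.2 h)]; congr 1; ring
    _ ≤ |a - b| ^ (p - 1) * |s| := by
        gcongr
    _ = |a - b| ^ (p - 2) * |a - b| * |s| := by
        rw [← Real.rpow_add_one ht0.ne']; congr 2; ring
    _ = _ := by rw [mul_assoc, ← hsign, mul_assoc]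

variable {E : Type*} [NormedAddCommGroup E] [NormedSpace ℝ E]

/-- Multiplying `min ((u - c)_+) k` by a cutoff at distance `1/k` from `Ωᶜ` costs at most the
Hardy term, uniformly in `k`. -/
theorem abs_cutoff_sub_le [Nontrivial E] {Ω : Set E} (ho : IsOpen Ω) (hb : Bornology.IsBounded Ω)
    {u : E → ℝ} (hu0 : ∀ x, 0 ≤ u x) (huΩ : ∀ x ∉ Ω, u x = 0) {c k : ℝ} (hc : 0 ≤ c) (hk : 0 < k)
    (x y : E) :
    |ramp (k * infDist x Ωᶜ) * min (max (u x - c) 0) k -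
        ramp (k * infDist y Ωᶜ) * min (max (u y - c) 0) k| ≤
      |u x - u y| + 2 * (u x * min 1 (‖x - y‖ / infDist x Ωᶜ)) := by
  set v : E → ℝ := fun x => min (max (u x - c) 0) k with hv
  have hv0 : ∀ x, 0 ≤ v x := fun x => le_min (le_max_right _ _) hk.le
  have hvu : ∀ x, v x ≤ u x := fun x =>
    (min_le_left _ _).trans (max_le (by linarith) (hu0 x))
  have hvv : |v x - v y| ≤ |u x - u y| := by
    have := abs_min_sub_min_le_max (max (u x - c) 0) k (max (u y - c) 0) k
    rw [sub_self, abs_zero, max_eq_left (abs_nonneg (max (u x - c) 0 - max (u y - c) 0))] at this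
    exact this.trans (abs_posPart_sub_le _ _ _)
  set η : E → ℝ := fun x => ramp (k * infDist x Ωᶜ) with hη
  have h1 : η x * v x - η y * v y = η y * (v x - v y) + v x * (η x - η y) := by ring
  have h2 : |η y * (v x - v y)| ≤ |u x - u y| := by
    rw [abs_mul, abs_of_nonneg (ramp_nonneg _)]
    calc η y * |v x - v y| ≤ 1 * |v x - v y| := by gcongr; exact ramp_le_one _
      _ ≤ _ := by rwa [one_mul]
  have h3 : |v x * (η x - η y)| ≤ 2 * (u x * min 1 (‖x - y‖ / infDist x Ωᶜ)) := by
    rw [abs_mul, abs_of_nonneg (hv0 x)]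
    by_cases hx : x ∈ Ω
    swap
    · have : v x = 0 := le_antisymm ((hvu x).trans (huΩ x hx).le) (hv0 x)
      simp [this, huΩ x hx]
    have hd := infDist_compl_pos ho hb hx
    have h4 : |η x - η y| ≤ 2 * min 1 (‖x - y‖ / infDist x Ωᶜ) := by
      refine (abs_ramp_sub_le_mul_min (by positivity)).trans ?_
      rw [← mul_sub, abs_mul, abs_of_pos hk, mul_div_mul_left _ _ hk.ne', ← dist_eq_norm]
      have := (lipschitz_infDist_pt (Ωᶜ)).dist_le_mul x y
      rw [Real.dist_eq, NNReal.coe_one, one_mul] at this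
      gcongr
    calc v x * |η x - η y| ≤ u x * (2 * min 1 (‖x - y‖ / infDist x Ωᶜ)) := by
          gcongr
          · exact hu0 x
          · exact hvu x
      _ = _ := by ring
  calc |η x * v x - η y * v y| ≤ |η y * (v x - v y)| + |v x * (η x - η y)| := by
        rw [h1]; exact abs_add_le _ _
    _ ≤ _ := add_le_add h2 h3

variable [FiniteDimensional ℝ E] [MeasurableSpace E] [BorelSpace E] (μ : Measure E)
  [μ.IsAddHaarMeasure]

theorem integrable_add_hardy_rpow [Nontrivial E] {d σ p : ℝ} (hd : d = Module.finrank ℝ E)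
    (hσ : 0 < σ) (hσp : σ < p) (hp : 1 < p) {Ω : Set E}
    (ho : IsOpen Ω) (hb : Bornology.IsBounded Ω) {ε R : ℝ} (hε : 0 < ε) (hR : 0 < R)
    (hcork : ExteriorCorkscrew Ω ε R) {u : E → ℝ} (hu : Measurable u) (hu0 : ∀ x, 0 ≤ u x)
    (huΩ : ∀ x ∉ Ω, u x = 0) (hE : gagliardo μ (d + σ) p u ≠ ⊤) :
    Integrable (fun z : E × E =>
      (|u z.1 - u z.2| + 2 * (u z.1 * min 1 (‖z.1 - z.2‖ / infDist z.1 Ωᶜ))) ^ p /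
        ‖z.1 - z.2‖ ^ (d + σ)) (μ.prod μ) := by
  have hm1 : Measurable fun z : E × E => infDist z.1 Ωᶜ :=
    ((continuous_infDist_pt Ωᶜ).comp continuous_fst).measurable
  have hm2 : Measurable fun z : E × E => ‖z.1 - z.2‖ :=
    (continuous_fst.sub continuous_snd).norm.measurable
  have hm3 : Measurable fun z : E × E => u z.1 := hu.comp measurable_fst
  have hm4 : Measurable fun z : E × E => |u z.1 - u z.2| := by
    have : Measurable fun z : E × E => u z.1 - u z.2 := hm3.sub (hu.comp measurable_snd)
    simpa only [Real.norm_eq_abs] using this.norm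
  have hm5 : Measurable fun z : E × E => u z.1 * min 1 (‖z.1 - z.2‖ / infDist z.1 Ωᶜ) :=
    hm3.mul (measurable_const.min (hm2.div hm1))
  have hpos : ∀ z : E × E, 0 ≤ u z.1 * min 1 (‖z.1 - z.2‖ / infDist z.1 Ωᶜ) := fun z =>
    mul_nonneg (hu0 _) (le_min zero_le_one (div_nonneg (norm_nonneg _) infDist_nonneg))
  have hH : Integrable (fun z : E × E =>
      (u z.1 * min 1 (‖z.1 - z.2‖ / infDist z.1 Ωᶜ)) ^ p / ‖z.1 - z.2‖ ^ (d + σ))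
      (μ.prod μ) := by
    refine ⟨((hm5.pow_const p).div (hm2.pow_const _)).aestronglyMeasurable, ?_⟩
    rw [hasFiniteIntegral_iff_ofReal (Eventually.of_forall fun z =>
      div_nonneg (Real.rpow_nonneg (hpos z) p) (by positivity))]
    exact (hardy_lintegral_ne_top μ hd hσ hσp ho hb hε hR hcork hu hu0 huΩ hE).lt_top
  refine (((integrable_of_gagliardo μ hu hE).add (hH.const_mul (2 ^ p))).const_mul
    (2 ^ (p - 1))).mono' (((hm4.add (hm5.const_mul 2)).pow_const p).div
      (hm2.pow_const _)).aestronglyMeasurable (Eventually.of_forall fun z => ?_)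
  have hb0 := hpos z
  have hK : 0 ≤ ‖z.1 - z.2‖ ^ (d + σ) := by positivity
  have ha0 := abs_nonneg (u z.1 - u z.2)
  rw [Real.norm_of_nonneg (div_nonneg (Real.rpow_nonneg (by positivity) p) hK)]
  simp only [Pi.add_apply]
  rw [mul_div_assoc', ← add_div, mul_div_assoc', ← Real.mul_rpow (by norm_num) hb0]
  refine div_le_div_of_nonneg_right ?_ hK
  have h := NNReal.rpow_add_le_mul_rpow_add_rpow ⟨_, ha0⟩
    ⟨2 * (u z.1 * min 1 (‖z.1 - z.2‖ / infDist z.1 Ωᶜ)), by positivity⟩ hp.le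
  exact_mod_cast h

/-- The energy inequality: the weak equation may be tested with `(u - c)_+`, as a subsolution
inequality. The test functions `ramp (k dist(x, Ωᶜ)) * min ((u - c)_+) k` have compact support in
`Ω`, stay below `(u - c)_+`, and converge under the form thanks to Hardy's inequality. -/
theorem gagliardo_posPart_le [Nontrivial E] {d σ p : ℝ} (hd : d = Module.finrank ℝ E)
    (hσ : 0 < σ) (hσp : σ < p) (hp : 1 < p) {Ω : Set E}
    (ho : IsOpen Ω) (hb : Bornology.IsBounded Ω) {ε R : ℝ} (hε : 0 < ε) (hR : 0 < R)
    (hcork : ExteriorCorkscrew Ω ε R) {u f : E → ℝ} (hu : Measurable u) (hu0 : ∀ x, 0 ≤ u x)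
    (huΩ : ∀ x ∉ Ω, u x = 0) (hE : gagliardo μ (d + σ) p u ≠ ⊤)
    (hweak : ∀ ψ : E → ℝ, ContDiff ℝ ∞ ψ → HasCompactSupport ψ → tsupport ψ ⊆ Ω →
      IntegrableOn (fun x => f x * ψ x) Ω μ ∧
        ∫ z, formIntegrand (d + σ) p u ψ z ∂(μ.prod μ) = ∫ x in Ω, f x * ψ x ∂μ)
    (hf0 : ∀ x ∈ Ω, 0 ≤ f x) {c : ℝ} (hc : 0 ≤ c)
    (hfw : IntegrableOn (fun x => f x * max (u x - c) 0) Ω μ) :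
    gagliardo μ (d + σ) p (fun x => max (u x - c) 0) ≠ ⊤ ∧
      (gagliardo μ (d + σ) p (fun x => max (u x - c) 0)).toReal ≤
        ∫ x in Ω, f x * max (u x - c) 0 ∂μ := by
  have hp0 : 0 < p := by linarith
  set w : E → ℝ := fun x => max (u x - c) 0 with hw
  have hwm : Measurable w := (hu.sub_const c).max measurable_const
  have hw0 : ∀ x, 0 ≤ w x := fun x => le_max_right _ _
  have hwE : gagliardo μ (d + σ) p w ≠ ⊤ :=
    ne_top_of_le_ne_top hE (gagliardo_mono hp0.le fun x y => abs_posPart_sub_le _ _ _)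
  refine ⟨hwE, ?_⟩
  set D : E × E → ℝ := fun z =>
    |u z.1 - u z.2| + 2 * (u z.1 * min 1 (‖z.1 - z.2‖ / infDist z.1 Ωᶜ)) with hD
  have hDint := integrable_add_hardy_rpow μ hd hσ hσp hp ho hb hε hR hcork hu hu0 huΩ hE
  set φ : ℕ → E → ℝ := fun k x =>
    ramp (((k : ℝ) + 1) * infDist x Ωᶜ) * min (w x) ((k : ℝ) + 1) with hφ
  have hkpos : ∀ k : ℕ, (0 : ℝ) < (k : ℝ) + 1 := fun k => by positivity
  have hφm : ∀ k, Measurable (φ k) := fun k =>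
    (continuous_ramp.comp ((continuous_infDist_pt Ωᶜ).const_mul _)).measurable.mul
      (hwm.min measurable_const)
  have hφD : ∀ k (z : E × E), |φ k z.1 - φ k z.2| ≤ D z := fun k z =>
    abs_cutoff_sub_le ho hb hu0 huΩ hc (hkpos k) z.1 z.2
  have hφ0 : ∀ k x, 0 ≤ φ k x := fun k x =>
    mul_nonneg (ramp_nonneg _) (le_min (hw0 x) (hkpos k).le)
  have hφw : ∀ k x, φ k x ≤ w x := fun k x => by
    calc φ k x ≤ 1 * min (w x) ((k : ℝ) + 1) :=
          mul_le_mul_of_nonneg_right (ramp_le_one _) (le_min (hw0 x) (hkpos k).le)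
      _ ≤ w x := by rw [one_mul]; exact min_le_left _ _
  have hφE : ∀ k, gagliardo μ (d + σ) p (φ k) ≠ ⊤ := fun k => by
    refine ne_top_of_le_ne_top hDint.lintegral_lt_top.ne (lintegral_mono fun z =>
      ENNReal.ofReal_le_ofReal (div_le_div_of_nonneg_right ?_ (by positivity)))
    exact Real.rpow_le_rpow (abs_nonneg _) (hφD k z) hp0.le
  have hform : ∀ k, ∫ z, formIntegrand (d + σ) p u (φ k) z ∂(μ.prod μ) =
      ∫ x in Ω, f x * φ k x ∂μ := by
    intro k
    have hsub : {x | 1 / ((k : ℝ) + 1) ≤ infDist x Ωᶜ} ⊆ Ω := by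
      intro x hx
      by_contra h
      have h1 : 1 / ((k : ℝ) + 1) ≤ infDist x Ωᶜ := hx
      rw [infDist_zero_of_mem (show x ∈ Ωᶜ from h)] at h1
      exact absurd h1 (not_le.2 (by positivity))
    refine weak_eq_of_isCompact μ hp ho hu hE hweak (hφm k) (hφE k) (M := (k : ℝ) + 1)
      (K := {x | 1 / ((k : ℝ) + 1) ≤ infDist x Ωᶜ}) (fun x => ?_) ?_ hsub fun x hx => ?_
    · rw [abs_of_nonneg (hφ0 k x)]
      calc φ k x ≤ 1 * min (w x) ((k : ℝ) + 1) :=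
            mul_le_mul_of_nonneg_right (ramp_le_one _) (le_min (hw0 x) (hkpos k).le)
        _ ≤ _ := by rw [one_mul]; exact min_le_right _ _
    · exact isCompact_of_isClosed_isBounded
        (isClosed_le continuous_const (continuous_infDist_pt _)) (hb.subset hsub)
    · have h1 : infDist x Ωᶜ < 1 / ((k : ℝ) + 1) := not_le.1 hx
      rw [lt_div_iff₀ (hkpos k)] at h1
      simp only [hφ]
      rw [ramp_of_le_one (by linarith), zero_mul]
  have hlim : ∀ x, Tendsto (fun k => φ k x) atTop (𝓝 (w x)) := by
    intro x
    refine tendsto_const_nhds.congr' ?_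
    by_cases hx : x ∈ Ω
    · have hdx := infDist_compl_pos ho hb hx
      filter_upwards [eventually_ge_atTop ⌈w x⌉₊, eventually_ge_atTop ⌈2 / infDist x Ωᶜ⌉₊]
        with k hk1 hk2
      have h1 : w x ≤ (k : ℝ) + 1 := by
        have : w x ≤ k := (Nat.le_ceil _).trans (by exact_mod_cast hk1)
        linarith
      have h2 : 2 ≤ ((k : ℝ) + 1) * infDist x Ωᶜ := by
        have : 2 / infDist x Ωᶜ ≤ k := (Nat.le_ceil _).trans (by exact_mod_cast hk2)
        rw [div_le_iff₀ hdx] at this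
        nlinarith
      simp only [hφ]
      rw [ramp_of_two_le h2, min_eq_left h1, one_mul]
    · have hwx : w x = 0 := by
        simp only [hw]
        rw [huΩ x hx]
        exact max_eq_right (by linarith)
      refine Eventually.of_forall fun k => ?_
      exact le_antisymm (by rw [hwx]; exact hφ0 k x) (hφw k x)
  have hformlim : Tendsto (fun k => ∫ z, formIntegrand (d + σ) p u (φ k) z ∂(μ.prod μ)) atTop
      (𝓝 (∫ z, formIntegrand (d + σ) p u w z ∂(μ.prod μ))) := by
    refine tendsto_integral_of_dominated_convergence (fun z =>
      1 * (|u z.1 - u z.2| ^ p / ‖z.1 - z.2‖ ^ (d + σ)) +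
        1 ^ (1 - p) * (D z ^ p / ‖z.1 - z.2‖ ^ (d + σ)))
      (fun k => (measurable_formIntegrand hu (hφm k)).aestronglyMeasurable)
      (((integrable_of_gagliardo μ hu hE).const_mul 1).add (hDint.const_mul _))
      (fun k => Eventually.of_forall fun z => norm_formIntegrand_le hp one_pos (hφD k z))
      (Eventually.of_forall fun z => ?_)
    exact (((hlim z.1).sub (hlim z.2)).const_mul _).div_const _
  calc (gagliardo μ (d + σ) p w).toReal
      = ∫ z : E × E, |w z.1 - w z.2| ^ p / ‖z.1 - z.2‖ ^ (d + σ) ∂(μ.prod μ) :=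
        (integral_eq_toReal_gagliardo μ hwm).symm
    _ ≤ ∫ z, formIntegrand (d + σ) p u w z ∂(μ.prod μ) := by
        refine integral_mono (integrable_of_gagliardo μ hwm hwE)
          (integrable_formIntegrand μ hp hu hwm hE hwE) fun z => ?_
        exact div_le_div_of_nonneg_right (abs_posPart_sub_rpow_le hp _ _ _) (by positivity)
    _ ≤ ∫ x in Ω, f x * w x ∂μ := by
        refine le_of_tendsto' hformlim fun k => ?_
        rw [hform k]
        refine integral_mono_of_nonneg ?_ hfw ?_
        · filter_upwards [ae_restrict_mem ho.measurableSet] with x hx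
          exact mul_nonneg (hf0 x hx) (hφ0 k x)
        · filter_upwards [ae_restrict_mem ho.measurableSet] with x hx
          exact mul_le_mul_of_nonneg_left (hφw k x) (hf0 x hx)

end Energy

/-! ### Boundedness -/

section Bounded

variable {E : Type*} [MeasurableSpace E]

/-- The mass `∫ ((u - c)_+)^q` of `u` above the level `c`. -/
noncomputable def levelMass (μ : Measure E) (q : ℝ) (u : E → ℝ) (c : ℝ) : ℝ :=
  ∫ x, max (u x - c) 0 ^ q ∂μ

theorem integrable_posPart_rpow {μ : Measure E} {q : ℝ} (hq : 0 ≤ q) {u : E → ℝ}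
    (hu : Measurable u) (hu0 : ∀ x, 0 ≤ u x) (hint : Integrable (fun x => u x ^ q) μ) {c : ℝ}
    (hc : 0 ≤ c) : Integrable (fun x => max (u x - c) 0 ^ q) μ := by
  refine hint.mono' (((hu.sub_const c).max measurable_const).pow_const q).aestronglyMeasurable
    (Eventually.of_forall fun x => ?_)
  rw [Real.norm_of_nonneg (by positivity)]
  exact Real.rpow_le_rpow (le_max_right _ _) (max_le (by linarith) (hu0 x)) hq

theorem levelMass_nonneg (μ : Measure E) (q : ℝ) (u : E → ℝ) (c : ℝ) : 0 ≤ levelMass μ q u c :=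
  integral_nonneg fun _ => Real.rpow_nonneg (le_max_right _ _) q

theorem levelMass_anti {μ : Measure E} {q : ℝ} (hq : 0 ≤ q) {u : E → ℝ}
    (hu : Measurable u) (hu0 : ∀ x, 0 ≤ u x) (hint : Integrable (fun x => u x ^ q) μ) {c' c : ℝ}
    (hc' : 0 ≤ c') (h : c' ≤ c) : levelMass μ q u c ≤ levelMass μ q u c' := by
  refine integral_mono (integrable_posPart_rpow hq hu hu0 hint (hc'.trans h))
    (integrable_posPart_rpow hq hu hu0 hint hc') fun x => ?_
  exact Real.rpow_le_rpow (le_max_right _ _) (max_le_max_right 0 (by linarith)) hq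

theorem tendsto_levelMass {μ : Measure E} {q : ℝ} (hq : 0 < q) {u : E → ℝ}
    (hu : Measurable u) (hu0 : ∀ x, 0 ≤ u x) (hint : Integrable (fun x => u x ^ q) μ) :
    Tendsto (levelMass μ q u) atTop (𝓝 0) := by
  rw [← integral_zero E ℝ (μ := μ)]
  refine tendsto_integral_filter_of_dominated_convergence (fun x => u x ^ q) ?_ ?_ hint ?_
  · exact Eventually.of_forall fun c =>
      (((hu.sub_const c).max measurable_const).pow_const q).aestronglyMeasurable
  · filter_upwards [eventually_ge_atTop 0] with c hc
    refine Eventually.of_forall fun x => ?_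
    rw [Real.norm_of_nonneg (Real.rpow_nonneg (le_max_right _ _) q)]
    exact Real.rpow_le_rpow (le_max_right _ _) (max_le (by linarith) (hu0 x)) hq.le
  · refine Eventually.of_forall fun x => tendsto_const_nhds.congr' ?_
    filter_upwards [eventually_ge_atTop (u x)] with c hc
    rw [max_eq_right (by linarith), Real.zero_rpow hq.ne']

/-- Above the higher level `c`, the value `u` is controlled by its excess over the lower level
`c'`. -/
theorem rpow_mul_posPart_le {γ a c' c : ℝ} (hγ : 0 < γ) (hc' : 0 ≤ c') (h : c' < c) (ha : c < a) :
    a ^ γ * (a - c) ≤ (c / (c - c')) ^ γ * max (a - c') 0 ^ (γ + 1) := by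
  have hcc : 0 < c - c' := by linarith
  have h1 : 0 < a - c' := by linarith
  have h2 : a ≤ c / (c - c') * (a - c') := by
    rw [div_mul_eq_mul_div, le_div_iff₀ hcc]
    nlinarith
  rw [max_eq_left h1.le, Real.rpow_add_one h1.ne', ← mul_assoc,
    ← Real.mul_rpow (div_nonneg (by linarith) hcc.le) h1.le]
  have ha0 : 0 ≤ a := by linarith
  have hac : 0 ≤ a - c := by linarith
  gcongr
  exact Real.rpow_nonneg (ha0.trans h2) γ

end Bounded

section Main

variable {E : Type*} [NormedAddCommGroup E] [NormedSpace ℝ E] [FiniteDimensional ℝ E]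
  [MeasurableSpace E] [BorelSpace E] (μ : Measure E) [μ.IsAddHaarMeasure]

/-- Boundedness of nonnegative weak solutions with a right-hand side of critical growth above the
level `1`. -/
theorem exists_ae_le_of_weak_eq [Nontrivial E] {d σ p : ℝ} (hd : d = Module.finrank ℝ E)
    (hσ : 0 < σ) (hσp : σ < p) (hσd : σ < d) (hp : 1 < p) {Ω : Set E}
    (ho : IsOpen Ω) (hb : Bornology.IsBounded Ω) {ε R : ℝ} (hε : 0 < ε) (hR : 0 < R)
    (hcork : ExteriorCorkscrew Ω ε R) {u f : E → ℝ} (hu : Measurable u) (hu0 : ∀ x, 0 ≤ u x)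
    (huΩ : ∀ x ∉ Ω, u x = 0) (hE : gagliardo μ (d + σ) p u ≠ ⊤)
    (hweak : ∀ ψ : E → ℝ, ContDiff ℝ ∞ ψ → HasCompactSupport ψ → tsupport ψ ⊆ Ω →
      IntegrableOn (fun x => f x * ψ x) Ω μ ∧
        ∫ z, formIntegrand (d + σ) p u ψ z ∂(μ.prod μ) = ∫ x in Ω, f x * ψ x ∂μ)
    (hfm : Measurable f) (hf0 : ∀ x ∈ Ω, 0 ≤ f x) {Λ : ℝ} (hΛ : 0 < Λ)
    (hf : ∀ x ∈ Ω, 1 ≤ u x → f x ≤ Λ * u x ^ (p * (d / (d - σ)) - 1)) :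
    ∃ M, ∀ᵐ x ∂μ, u x ≤ M := by
  have hp0 : 0 < p := by linarith
  have hd0 : 0 < d := by linarith
  have hdσ : 0 < d - σ := by linarith
  set β := d / (d - σ) with hβ
  have hβ1 : 1 < β := by rw [hβ, one_lt_div hdσ]; linarith
  have hβσ : β * (1 - σ / d) = 1 := by rw [hβ]; field_simp
  set q := p * β with hq
  have hq1 : 1 < q := by rw [hq]; nlinarith
  have hγ : 0 < q - 1 := by linarith
  have hΩμ : μ Ω ≠ ⊤ := hb.measure_lt_top.ne
  obtain ⟨C, hC, hsob⟩ := exists_sobolev μ hd hσ.le hp0 (by linarith : 0 < β) hβσ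
  have hint : Integrable (fun x => u x ^ q) μ := by
    refine ⟨(hu.pow_const q).aestronglyMeasurable, ?_⟩
    rw [hasFiniteIntegral_iff_ofReal (Eventually.of_forall fun x => Real.rpow_nonneg (hu0 x) q)]
    exact (hsob u hu hu0 Ω huΩ hΩμ hE).trans_lt ENNReal.ofReal_lt_top
  have hpt : ∀ c' c, 1 ≤ c' → c' < c → ∀ x ∈ Ω, f x * max (u x - c) 0 ≤
      Λ * (c / (c - c')) ^ (q - 1) * max (u x - c') 0 ^ q := by
    intro c' c hc' h x hx
    have hr : 0 ≤ c / (c - c') := div_nonneg (by linarith) (by linarith)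
    rcases le_or_gt (u x) c with hux | hux
    · rw [max_eq_right (by linarith), mul_zero]
      exact mul_nonneg (by positivity) (Real.rpow_nonneg (le_max_right _ _) q)
    · rw [max_eq_left (by linarith : 0 ≤ u x - c)]
      have h1 := rpow_mul_posPart_le hγ (by linarith : 0 ≤ c') h hux
      rw [sub_add_cancel] at h1
      calc f x * (u x - c) ≤ Λ * u x ^ (q - 1) * (u x - c) :=
            mul_le_mul_of_nonneg_right (hf x hx (by linarith)) (by linarith)
        _ = Λ * (u x ^ (q - 1) * (u x - c)) := by ring
        _ ≤ Λ * ((c / (c - c')) ^ (q - 1) * max (u x - c') 0 ^ q) := by gcongr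
        _ = _ := by ring
  have hrec : ∀ c' c, 1 ≤ c' → c' < c → levelMass μ q u c ≤
      (C * Λ * (c / (c - c')) ^ (q - 1) * levelMass μ q u c') ^ β := by
    intro c' c hc' h
    have hc0 : 0 ≤ c := by linarith
    set r := (c / (c - c')) ^ (q - 1) with hrdef
    have hr : 0 ≤ r := Real.rpow_nonneg (div_nonneg hc0 (by linarith)) _
    have hintc' := integrable_posPart_rpow (by linarith : 0 ≤ q) hu hu0 hint
      (by linarith : 0 ≤ c')
    have hfw : IntegrableOn (fun x => f x * max (u x - c) 0) Ω μ := by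
      refine ((hintc'.const_mul (Λ * r)).integrableOn (s := Ω)).mono'
        (hfm.mul ((hu.sub_const c).max measurable_const)).aestronglyMeasurable ?_
      filter_upwards [ae_restrict_mem ho.measurableSet] with x hx
      rw [Real.norm_of_nonneg (mul_nonneg (hf0 x hx) (le_max_right _ _))]
      exact hpt c' c hc' h x hx
    obtain ⟨hwE, hwle⟩ := gagliardo_posPart_le μ hd hσ hσp hp ho hb hε hR hcork hu hu0 huΩ hE
      hweak hf0 hc0 hfw
    have hfle : ∫ x in Ω, f x * max (u x - c) 0 ∂μ ≤ Λ * r * levelMass μ q u c' := by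
      rw [levelMass, ← integral_const_mul]
      refine (setIntegral_mono_on hfw (hintc'.const_mul (Λ * r)).integrableOn ho.measurableSet
        (hpt c' c hc' h)).trans (setIntegral_le_integral (hintc'.const_mul (Λ * r)) ?_)
      exact Eventually.of_forall fun x =>
        mul_nonneg (by positivity) (Real.rpow_nonneg (le_max_right _ _) q)
    have hS := hsob (fun x => max (u x - c) 0) ((hu.sub_const c).max measurable_const)
      (fun x => le_max_right _ _) Ω (fun x hx => by simp [huΩ x hx, hc0]) hΩμ hwE
    have hintc := integrable_posPart_rpow (by linarith : 0 ≤ q) hu hu0 hint hc0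
    rw [← ofReal_integral_eq_lintegral_ofReal hintc (Eventually.of_forall fun x =>
      Real.rpow_nonneg (le_max_right _ _) q), ENNReal.ofReal_le_ofReal_iff (by positivity)] at hS
    refine hS.trans (Real.rpow_le_rpow (by positivity) ?_ (by linarith))
    calc C * (gagliardo μ (d + σ) p fun x => max (u x - c) 0).toReal
        ≤ C * (Λ * r * levelMass μ q u c') := by
          gcongr
          exact hwle.trans hfle
      _ = _ := by ring
  -- `levelMass` is only monotone on nonnegative levels, so negative levels are sent to `0`.
  obtain ⟨M, hM⟩ := exists_eq_zero_of_level_recursion (A := fun c => levelMass μ q u (max c 0))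
    (C := C * Λ) (γ := q - 1) (β := β) (by positivity) hγ hβ1 (fun c => levelMass_nonneg _ _ _ _)
    (fun a b hab => levelMass_anti (by linarith) hu hu0 hint (le_max_right _ _)
      (max_le_max_right 0 hab))
    ((tendsto_levelMass (by linarith) hu hu0 hint).comp
      (tendsto_atTop_mono (fun c => le_max_left c 0) tendsto_id))
    (fun c' c hc' h => by
      simp only [max_eq_left (by linarith : (0 : ℝ) ≤ c'), max_eq_left (by linarith : (0 : ℝ) ≤ c)]
      exact hrec c' c hc' h)
  refine ⟨max M 0, ?_⟩
  have hzero := (integral_eq_zero_iff_of_nonneg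
    (fun x => Real.rpow_nonneg (le_max_right _ _) q)
    (integrable_posPart_rpow (by linarith : 0 ≤ q) hu hu0 hint (le_max_right M 0))).1 hM
  filter_upwards [hzero] with x hx
  have h1 := (Real.rpow_eq_zero (le_max_right (u x - max M 0) 0) (by linarith)).1 hx
  linarith [max_eq_right_iff.1 h1]

end Main

/-! ### Reduction to a good representative -/

section Reduction

variable {n : ℕ} {Ω : Set (EuclideanSpace ℝ (Fin n))} {s p lam q α : ℝ}
  {u : EuclideanSpace ℝ (Fin n) → ℝ}

/-- A measurable, everywhere nonnegative representative that vanishes identically off `Ω`. -/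
theorem IsPositiveWeakSolution.exists_representative (ho : IsOpen Ω)
    (hu : IsPositiveWeakSolution Ω s p lam q α u) :
    ∃ v : EuclideanSpace ℝ (Fin n) → ℝ, Measurable v ∧ (∀ x, 0 ≤ v x) ∧ (∀ x ∉ Ω, v x = 0) ∧
      u =ᵐ[volume] v := by
  have hm := hu.memX0.memX.aemeasurable
  refine ⟨Ω.indicator fun x => max (hm.mk u x) 0,
    (hm.measurable_mk.max measurable_const).indicator ho.measurableSet,
    fun x => Set.indicator_nonneg (fun _ _ => le_max_right _ _) x,
    fun x hx => Set.indicator_of_notMem hx _, ?_⟩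
  filter_upwards [hm.ae_eq_mk, hu.pos, hu.memX0.eq_zero] with x h1 h2 h3
  by_cases hx : x ∈ Ω
  · rw [Set.indicator_of_mem hx, ← h1, max_eq_left (h2 hx).le]
  · rw [Set.indicator_of_notMem hx, h3 hx]

theorem ae_prod_eq {v : EuclideanSpace ℝ (Fin n) → ℝ} (huv : u =ᵐ[volume] v) :
    ∀ᵐ z : EuclideanSpace ℝ (Fin n) × EuclideanSpace ℝ (Fin n) ∂(volume.prod volume),
      u z.1 = v z.1 ∧ u z.2 = v z.2 := by
  filter_upwards [Measure.quasiMeasurePreserving_fst.ae_eq_comp huv,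
    Measure.quasiMeasurePreserving_snd.ae_eq_comp huv] with z h1 h2 using ⟨h1, h2⟩

theorem measurableSet_Q (ho : IsOpen Ω) : MeasurableSet (Q Ω) :=
  (ho.measurableSet.compl.prod ho.measurableSet.compl).compl

theorem notMem_of_notMem_Q {z : EuclideanSpace ℝ (Fin n) × EuclideanSpace ℝ (Fin n)}
    (hz : z ∉ Q Ω) : z.1 ∉ Ω ∧ z.2 ∉ Ω := by
  simpa [Q] using hz

theorem MemX.gagliardo_ne_top (hp : 0 < p) (ho : IsOpen Ω) (hu : MemX Ω s p u)
    {v : EuclideanSpace ℝ (Fin n) → ℝ} (hv : ∀ x ∉ Ω, v x = 0) (huv : u =ᵐ[volume] v) :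
    gagliardo volume ((n : ℝ) + s * p) p v ≠ ⊤ := by
  rw [gagliardo_eq_eLpNorm_rpow _ hp]
  refine ENNReal.rpow_ne_top_of_nonneg hp.le ?_
  have h1 : (fun z : EuclideanSpace ℝ (Fin n) × EuclideanSpace ℝ (Fin n) =>
      (v z.1 - v z.2) / ‖z.1 - z.2‖ ^ (((n : ℝ) + s * p) / p)) =
      (Q Ω).indicator fun z => (v z.1 - v z.2) / ‖z.1 - z.2‖ ^ (((n : ℝ) + s * p) / p) := by
    symm
    rw [Set.indicator_eq_self]
    intro z hz
    by_contra hzQ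
    obtain ⟨h1, h2⟩ := notMem_of_notMem_Q hzQ
    exact hz (by simp [hv _ h1, hv _ h2])
  rw [h1, eLpNorm_indicator_eq_eLpNorm_restrict (measurableSet_Q ho)]
  refine ne_of_eq_of_ne (eLpNorm_congr_ae ?_) hu.memLp_quotient.eLpNorm_ne_top
  refine ae_restrict_of_ae ?_
  filter_upwards [ae_prod_eq huv] with z hz
  rw [hz.1, hz.2]

theorem IsTestFunction.eq_zero {ψ : EuclideanSpace ℝ (Fin n) → ℝ} (hψ : IsTestFunction Ω ψ)
    {x : EuclideanSpace ℝ (Fin n)} (hx : x ∉ Ω) : ψ x = 0 :=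
  image_eq_zero_of_notMem_tsupport fun h => hx (hψ.tsupport_subset h)

theorem weakForm_eq_integral_formIntegrand (ho : IsOpen Ω)
    {v ψ : EuclideanSpace ℝ (Fin n) → ℝ} (huv : u =ᵐ[volume] v) (hψ : IsTestFunction Ω ψ) :
    weakForm Ω s p u ψ =
      ∫ z, formIntegrand ((n : ℝ) + s * p) p v ψ z ∂(volume.prod volume) := by
  rw [← setIntegral_eq_integral_of_forall_compl_eq_zero (s := Q Ω)]
  · refine setIntegral_congr_ae (measurableSet_Q ho) ?_
    filter_upwards [ae_prod_eq huv] with z hz _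
    rw [formIntegrand, hz.1, hz.2]
  · intro z hz
    obtain ⟨h1, h2⟩ := notMem_of_notMem_Q hz
    simp [formIntegrand, hψ.eq_zero h1, hψ.eq_zero h2]

end Reduction

end FracPLap

theorem theorem6p3 (n : ℕ) (Ω : Set (EuclideanSpace ℝ (Fin n))) (s p lam q α : ℝ)
    (hΩ : FracPLap.IsSmoothBoundedDomain Ω)
    (hs0 : 0 < s) (hs1 : s < 1) (hp : 1 < p) (hn : s * p < (n : ℝ))
    (hlam : 0 < lam) (hq0 : 0 < q) (hq1 : q ≤ 1)
    (hα : α ≤ FracPLap.critExp n s p - 1)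
    (u : EuclideanSpace ℝ (Fin n) → ℝ)
    (hu : FracPLap.IsPositiveWeakSolution Ω s p lam q α u) :
    MeasureTheory.MemLp u ⊤ (MeasureTheory.volume.restrict Ω) := by
  have hp0 : 0 < p := by linarith
  have hsp : 0 < s * p := by positivity
  have : NeZero n := ⟨by rintro rfl; rw [Nat.cast_zero] at hn; linarith⟩
  obtain ⟨v, hvm, hv0, hvΩ, huv⟩ := hu.exists_representative hΩ.isOpen
  obtain ⟨ε, hε, R, hR, hcork⟩ :=
    FracPLap.exists_exteriorCorkscrew hΩ.isOpen hΩ.isBounded hΩ.smooth_boundary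
  obtain ⟨M, hM⟩ := FracPLap.exists_ae_le_of_weak_eq volume (d := n) (σ := s * p) (p := p)
    (f := fun x => lam * v x ^ (-q) + v x ^ α) (Λ := lam + 1)
    (by rw [finrank_euclideanSpace_fin]) hsp (by nlinarith) hn hp hΩ.isOpen hΩ.isBounded hε hR
    hcork hvm hv0 hvΩ (hu.memX0.memX.gagliardo_ne_top hp0 hΩ.isOpen hvΩ huv)
    (by
      intro ψ h1 h2 h3
      have hψ : FracPLap.IsTestFunction Ω ψ := ⟨h1, h2, h3⟩
      have hae : (fun x => (lam * u x ^ (-q) + u x ^ α) * ψ x) =ᵐ[volume.restrict Ω]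
          fun x => (lam * v x ^ (-q) + v x ^ α) * ψ x := by
        filter_upwards [ae_restrict_of_ae huv] with x hx
        rw [hx]
      refine ⟨(hu.integrableOn ψ hψ).congr hae, ?_⟩
      rw [← integral_congr_ae hae,
        ← FracPLap.weakForm_eq_integral_formIntegrand hΩ.isOpen huv hψ]
      exact sub_eq_zero.1 (hu.weak_eq ψ hψ))
    ((measurable_const.mul (hvm.pow_const _)).add (hvm.pow_const _))
    (fun x _ => add_nonneg (mul_nonneg hlam.le (Real.rpow_nonneg (hv0 x) _))
      (Real.rpow_nonneg (hv0 x) _))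
    (by linarith)
    (by
      intro x _ hx
      have hγ : α ≤ p * (n / (n - s * p)) - 1 := by
        rw [FracPLap.critExp] at hα
        convert hα using 2
        ring
      have hγ0 : 0 ≤ p * ((n : ℝ) / (n - s * p)) - 1 := by
        have : 1 ≤ (n : ℝ) / (n - s * p) := by
          rw [one_le_div (by linarith)]; linarith
        nlinarith
      have h1 : v x ^ (-q) ≤ v x ^ (p * (n / (n - s * p)) - 1) :=
        Real.rpow_le_rpow_of_exponent_le hx (by linarith)
      have h2 : v x ^ α ≤ v x ^ (p * (n / (n - s * p)) - 1) :=
        Real.rpow_le_rpow_of_exponent_le hx hγ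
      nlinarith)
  refine memLp_top_of_bound hu.memX0.memX.memLp.aestronglyMeasurable M ?_
  filter_upwards [ae_restrict_of_ae hM, ae_restrict_of_ae huv] with x h1 h2
  rw [h2, Real.norm_of_nonneg (hv0 x)]
  exact h1
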